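/- Let $(\Sigma,\partial)$ be a differential field of characteristic zero with field of constants $\mathbf C$, let $n\ge 1$, and let $$L=\partial^n+\upsilon_2\partial^{n-2}+\cdots+\upsilon_{n-1}\partial+\upsilon_n\in\Sigma[\partial]$$ be a differential operator of order $n$ in normal form. Notation. $\mathcal Z(L)$ is the centralizer of $L$ in $\Sigma[\partial]$, $\mathcal Z_m(L)$ is the $\mathbf C$-subspace of its elements of order at most $m$, and $\mathbf C[L]$ is the ring of polynomials in $L$ with constant coefficients. Let $d$ be the number of classes modulo $n$ of the orders of the nonzero elements of $\mathcal Z(L)$. Let $L_n=\partial^n+u_2\partial^{n-2}+\cdots+u_n$ be the formal operator whose coefficients are differential variables over $\mathbf C$, let $L_n^{1/n}$ be its unique monic $n$-th root in the ring of pseudo-differential operators over $\mathbf C\{u_2,\dots,u_n\}$, let $P_j=(L_n^{j/n})_+$ be the positive part of its $j$-th power, and let $H_{k,j}$ be the coefficient of $\partial^k$ in $[P_j,L_n]$. Let $B_j$ and $\sigma_{k,j}$ be obtained from $P_j$ and $H_{k,j}$ by the differential specialization $u_\ell\mapsto\upsilon_\ell$, and put $\overline\sigma_j=(\sigma_{0,j},\dots,\sigma_{n-2,j})$.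 Given $M_0=0<M_1<\cdots<M_{d-1}$, put $$J^*_{n,m-1}=\{0,1,\dots,m-1\}\setminus\bigcup_{M_k<m}\{M_k+hn : h\in\mathbb Z_{\ge 0}\},$$ and let $\mathrm{GD}^*_{n,m}(L)$ be the linear system $\overline\sigma_m+\sum_{j\in J^*_{n,m-1}}c_j\overline\sigma_j=\overline 0$ in the unknowns $c_j$. Theorem. There exists a unique basis $\mathcal G^*(L)=\{1,G_1^*,\dots,G_{d-1}^*\}$ of $\mathcal Z(L)$ as a $\mathbf C[L]$-module satisfying the following conditions. 1. The orders $M_i=\operatorname{ord}(G_i^*)$ form a strictly increasing sequence $0<M_1<\cdots<M_{d-1}$. 2. For each $i\in\{1,\dots,d-1\}$, the natural map is an isomorphism of $\mathbf C$-vector spaces $$\mathbf C\,G_i^*\;\simeq\;\frac{\mathcal Z_{M_i}(L)}{\mathcal Z_{M_i-1}(L)}.$$ 3. For each $i\in\{1,\dots,d-1\}$, the system $\mathrm{GD}^*_{n,M_i}(L)$ has exactly one solution $(\mathbf c^*_{M_i,j})_{j\in J^*_{n,M_i-1}}$ with entries in $\mathbf C$, and $$G_i^*=B_{M_i}+\sum_{j\in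 J^*_{n,M_i-1}}\mathbf c^*_{M_i,j}\,B_j .$$ -/

import Mathlib

open scoped Differential

/-- Formal pseudo-differential operators `∑_{i ≤ N} a_i ∂^i` with coefficients in `R`. -/
@[ext] structure PsiDO (R : Type*) [CommRing R] where
  /-- `A.coeff i` is the coefficient of `∂^i`. -/
  coeff : ℤ → R
  bdd : ∃ N : ℤ, ∀ i, N < i → coeff i = 0

namespace PsiDO

section Aux

variable {R : Type*} [CommRing R]

instance : Zero (PsiDO R) := ⟨⟨fun _ => 0, 0, fun _ _ => rfl⟩⟩

instance : Add (PsiDO R) where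
  add A B := ⟨fun i => A.coeff i + B.coeff i, by
    obtain ⟨N, hN⟩ := A.bdd
    obtain ⟨M, hM⟩ := B.bdd
    refine ⟨max N M, fun i hi => ?_⟩
    rw [hN i (lt_of_le_of_lt (le_max_left _ _) hi), hM i (lt_of_le_of_lt (le_max_right _ _) hi),
      add_zero]⟩

instance : Neg (PsiDO R) where
  neg A := ⟨fun i => -A.coeff i, by
    obtain ⟨N, hN⟩ := A.bdd
    exact ⟨N, fun i hi => by rw [hN i hi, neg_zero]⟩⟩

/-- The operator `a ∂^i`. -/
def monomial (a : R) (i : ℤ) : PsiDO R :=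
  ⟨fun j => if j = i then a else 0, i, fun j hj => if_neg (by omega)⟩

instance : One (PsiDO R) := ⟨monomial 1 0⟩

@[simp] theorem zero_coeff (i : ℤ) : (0 : PsiDO R).coeff i = 0 := rfl
@[simp] theorem add_coeff (A B : PsiDO R) (i : ℤ) : (A + B).coeff i = A.coeff i + B.coeff i := rfl
@[simp] theorem neg_coeff (A : PsiDO R) (i : ℤ) : (-A).coeff i = -A.coeff i := rfl
theorem monomial_coeff (a : R) (i j : ℤ) : (monomial a i).coeff j = if j = i then a else 0 := rfl
theorem one_coeff (j : ℤ) : (1 : PsiDO R).coeff j = if j = 0 then 1 else 0 := rfl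

theorem exists_bdd₃ (A B C : PsiDO R) : ∃ N : ℤ, (∀ i, N < i → A.coeff i = 0) ∧
    (∀ i, N < i → B.coeff i = 0) ∧ (∀ i, N < i → C.coeff i = 0) := by
  obtain ⟨N1, h1⟩ := A.bdd
  obtain ⟨N2, h2⟩ := B.bdd
  obtain ⟨N3, h3⟩ := C.bdd
  have a1 : N1 ≤ max N1 (max N2 N3) := by simp
  have a2 : N2 ≤ max N1 (max N2 N3) := by simp
  have a3 : N3 ≤ max N1 (max N2 N3) := by simp
  exact ⟨max N1 (max N2 N3), fun i hi => h1 i (by omega), fun i hi => h2 i (by omega),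
    fun i hi => h3 i (by omega)⟩

/-- `A` is monic of order `n`. -/
def IsMonicOfOrder (A : PsiDO R) (n : ℤ) : Prop :=
  A.coeff n = 1 ∧ ∀ i, n < i → A.coeff i = 0

theorem isMonicOfOrder_one : (1 : PsiDO R).IsMonicOfOrder 0 :=
  ⟨by simp [one_coeff], fun i hi => by rw [one_coeff, if_neg (by omega)]⟩

theorem sum_window (f : ℕ → ℕ → R) (L : Finset ℤ) (x y m w: ℤ) (hw : w = x + y - m)
    (hL : ∀ l, m ≤ l + y → l ≤ x → l ∈ L) :
    (∑ l ∈ L, if m ≤ l + y ∧ l ≤ x then f (x - l).toNat (l + y - m).toNat else 0) =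
      if 0 ≤ w then ∑ u ∈ Finset.HasAntidiagonal.antidiagonal w.toNat, f u.1 u.2 else 0 := by
  rw [← Finset.sum_filter]
  split_ifs with h
  · refine Finset.sum_bij' (fun l _ => ((x - l).toNat, (l + y - m).toNat))
      (fun u _ => x - u.1) ?_ ?_ ?_ ?_ ?_
    · intro l hl
      simp only [Finset.mem_filter] at hl
      simp only [Finset.HasAntidiagonal.mem_antidiagonal]; omega
    · rintro ⟨p, q⟩ hu
      simp only [Finset.HasAntidiagonal.mem_antidiagonal] at hu
      simp only [Finset.mem_filter]
      have : m ≤ x - p + y := by omega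
      have h2 : x - (p : ℤ) ≤ x := by omega
      exact ⟨hL _ this h2, this, h2⟩
    · intro l hl
      simp only [Finset.mem_filter] at hl
      simp only; omega
    · rintro ⟨p, q⟩ hu
      simp only [Finset.HasAntidiagonal.mem_antidiagonal] at hu
      ext <;> simp only <;> omega
    · intros; rfl
  · apply Finset.sum_eq_zero
    intro l hl
    simp only [Finset.mem_filter] at hl
    omega

end Aux

section Ring

variable {R : Type*} [CommRing R] [Differential R]

/-- The contribution of `a_i ∂^i` and `b_j ∂^j` to the coefficient of `∂^m` in a product. -/
noncomputable def mulTerm (a b : ℤ → R) (m i j : ℤ) : R :=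
  if m ≤ i + j then
    Ring.choose i (i + j - m).toNat • (a i * (fun r : R => r′)^[(i + j - m).toNat] (b j))
  else 0

/-- The coefficient of `∂^m` in the product of `∑ a_i ∂^i` and `∑ b_j ∂^j`, from the rule
`∂^i b = ∑_{p ≥ 0} (i choose p) b^{(p)} ∂^{i-p}` for every integer `i`; only finitely many terms
are nonzero for coefficient sequences that are bounded above. -/
noncomputable def mulCoeff (a b : ℤ → R) (m : ℤ) : R :=
  ∑ᶠ x : ℤ × ℤ, mulTerm a b m x.1 x.2

theorem iter_zero (p : ℕ) : (fun r : R => r′)^[p] 0 = 0 := by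
  induction p with
  | zero => rfl
  | succ p ih => rw [Function.iterate_succ_apply', ih]; simp

theorem iter_add (p : ℕ) (x y : R) : (fun r : R => r′)^[p] (x + y) =
    (fun r : R => r′)^[p] x + (fun r : R => r′)^[p] y := by
  induction p with
  | zero => rfl
  | succ p ih => simp only [Function.iterate_succ_apply', ih, map_add]

/-- The `p`-th iterate of the derivation. -/
noncomputable def iterHom (p : ℕ) : R →+ R where
  toFun := (fun r : R => r′)^[p]
  map_zero' := iter_zero p
  map_add' := iter_add p

theorem iter_leibniz (s : ℕ) (x y : R) : (fun r : R => r′)^[s] (x * y) =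
    ∑ u ∈ Finset.HasAntidiagonal.antidiagonal s, s.choose u.1 •
      ((fun r : R => r′)^[u.1] x * (fun r : R => r′)^[u.2] y) := by
  induction s with
  | zero => simp
  | succ s ih =>
    have key := Finset.sum_antidiagonal_choose_succ_nsmul
      (fun i j => (fun r : R => r′)^[i] x * (fun r : R => r′)^[j] y) s
    rw [key, Function.iterate_succ_apply', ih, map_sum, ← Finset.sum_add_distrib]
    refine Finset.sum_congr rfl fun u hu => ?_
    rw [map_nsmul, Derivation.leibniz, Nat.choose_symm_of_eq_add (by
      rw [Finset.HasAntidiagonal.mem_antidiagonal] at hu; omega : s = u.2 + u.1)]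
    simp only [Function.iterate_succ_apply', smul_eq_mul, nsmul_add]
    ring

theorem choose_identity (i j : ℤ) (p q : ℕ) :
    Ring.choose i p * Ring.choose (i + j - p) q =
      ∑ u ∈ Finset.HasAntidiagonal.antidiagonal q,
        Ring.choose i (p + u.1) * Ring.choose j u.2 * ((p + u.1).choose p : ℤ) := by
  have h : i + j - p = (i - p) + j := by ring
  rw [h, Ring.add_choose_eq q (Commute.all _ _), Finset.mul_sum]
  refine Finset.sum_congr rfl fun u _ => ?_
  have := Ring.choose_smul_choose i (Nat.le_add_right p u.1)
  rw [Nat.add_sub_cancel_left, nsmul_eq_mul] at this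
  rw [← mul_assoc, ← this]; ring

theorem mono_assoc (a b c : R) (i j : ℤ) (w : ℕ) :
    ∑ u ∈ Finset.HasAntidiagonal.antidiagonal w, (Ring.choose i u.1 * Ring.choose (i + j - u.1) u.2) •
      (a * (fun r : R => r′)^[u.1] b * (fun r : R => r′)^[u.2] c) =
    ∑ u ∈ Finset.HasAntidiagonal.antidiagonal w, (Ring.choose i u.1 * Ring.choose j u.2) •
      (a * (fun r : R => r′)^[u.1] (b * (fun r : R => r′)^[u.2] c)) := by
  simp only [iter_leibniz, choose_identity, Finset.sum_smul, Finset.mul_sum, Finset.smul_sum]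
  rw [Finset.sum_sigma', Finset.sum_sigma']
  refine Finset.sum_nbij' (fun x => ⟨(x.1.1 + x.2.1, x.2.2), (x.1.1, x.2.1)⟩)
    (fun x => ⟨(x.2.1, x.2.2 + x.1.2), (x.2.2, x.1.2)⟩) ?_ ?_ ?_ ?_ ?_
  · rintro ⟨⟨p, q⟩, ⟨t, r⟩⟩ h
    simp at h ⊢; omega
  · rintro ⟨⟨p, q⟩, ⟨t, r⟩⟩ h
    simp at h ⊢; omega
  · rintro ⟨⟨p, q⟩, ⟨t, r⟩⟩ h
    simp at h ⊢; omega
  · rintro ⟨⟨p, q⟩, ⟨t, r⟩⟩ h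
    simp at h ⊢; omega
  · rintro ⟨⟨p, q⟩, ⟨t, r⟩⟩ h
    simp only [Finset.mem_sigma, Finset.HasAntidiagonal.mem_antidiagonal] at h
    obtain ⟨h1, rfl⟩ := h
    simp only [← Function.iterate_add_apply, zsmul_eq_mul, nsmul_eq_mul]
    push_cast
    ring

theorem mulTerm_eq_zero {a b : ℤ → R} {m i j : ℤ} (h : a i = 0 ∨ b j = 0 ∨ i + j < m) :
    mulTerm a b m i j = 0 := by
  unfold mulTerm
  split_ifs with hm
  · rcases h with h | h | h
    · simp [h]
    · simp [h]
    · omega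
  · rfl

theorem mulCoeff_eq_sum_of_ne {a b : ℤ → R} {m : ℤ} (S T : Finset ℤ)
    (h : ∀ i j, mulTerm a b m i j ≠ 0 → i ∈ S ∧ j ∈ T) :
    mulCoeff a b m = ∑ i ∈ S, ∑ j ∈ T, mulTerm a b m i j := by
  unfold mulCoeff
  rw [finsum_eq_sum_of_support_subset (s := S ×ˢ T), Finset.sum_product]
  rintro ⟨i, j⟩ hx
  simpa using h i j hx

theorem mulCoeff_eq_sum {a b : ℤ → R} {m : ℤ} (S T : Finset ℤ)
    (h : ∀ i j, m ≤ i + j → a i ≠ 0 → b j ≠ 0 → i ∈ S ∧ j ∈ T) :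
    mulCoeff a b m = ∑ i ∈ S, ∑ j ∈ T, mulTerm a b m i j := by
  refine mulCoeff_eq_sum_of_ne S T fun i j hx => ?_
  by_contra hc
  apply hx
  apply mulTerm_eq_zero
  by_contra! h'
  exact hc (h i j h'.2.2 h'.1 h'.2.1)

theorem mulCoeff_eq_box {a b : ℤ → R} {N M m : ℤ} (ha : ∀ i, N < i → a i = 0)
    (hb : ∀ i, M < i → b i = 0) {l l' : ℤ} (hl : l ≤ m - M) (hl' : l' ≤ m - N) :
    mulCoeff a b m = ∑ i ∈ Finset.Icc l N, ∑ j ∈ Finset.Icc l' M, mulTerm a b m i j := by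
  apply mulCoeff_eq_sum
  intro i j hm hi hj
  have h1 : i ≤ N := by by_contra! h; exact hi (ha _ h)
  have h2 : j ≤ M := by by_contra! h; exact hj (hb _ h)
  simp only [Finset.mem_Icc]; omega

theorem mulCoeff_eq_zero {a b : ℤ → R} {N M m : ℤ} (ha : ∀ i, N < i → a i = 0)
    (hb : ∀ i, M < i → b i = 0) (hm : N + M < m) : mulCoeff a b m = 0 := by
  rw [mulCoeff_eq_sum (a := a) (b := b) ∅ ∅]
  · simp
  intro i j hm hi hj
  have h1 : i ≤ N := by by_contra! h; exact hi (ha _ h)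
  have h2 : j ≤ M := by by_contra! h; exact hj (hb _ h)
  omega

noncomputable instance : Mul (PsiDO R) where
  mul A B := ⟨mulCoeff A.coeff B.coeff, by
    obtain ⟨N, hN⟩ := A.bdd
    obtain ⟨M, hM⟩ := B.bdd
    exact ⟨N + M, fun i hi => mulCoeff_eq_zero hN hM hi⟩⟩

theorem mul_coeff (A B : PsiDO R) (m : ℤ) : (A * B).coeff m = mulCoeff A.coeff B.coeff m := rfl

protected theorem mul_assoc_aux (A B C : PsiDO R) : A * B * C = A * (B * C) := by
  obtain ⟨N1, h1⟩ := A.bdd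
  obtain ⟨N2, h2⟩ := B.bdd
  obtain ⟨N3, h3⟩ := C.bdd
  obtain ⟨N, hN1, hN2, hN3⟩ : ∃ N, N1 ≤ N ∧ N2 ≤ N ∧ N3 ≤ N :=
    ⟨max N1 (max N2 N3), by simp, by simp, by simp⟩
  replace h1 : ∀ i, N < i → A.coeff i = 0 := fun i hi => h1 i (by omega)
  replace h2 : ∀ i, N < i → B.coeff i = 0 := fun i hi => h2 i (by omega)
  replace h3 : ∀ i, N < i → C.coeff i = 0 := fun i hi => h3 i (by omega)
  have h12 : ∀ i, 2 * N < i → (A * B).coeff i = 0 := fun i hi =>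
    mulCoeff_eq_zero h1 h2 (by omega)
  have h23 : ∀ i, 2 * N < i → (B * C).coeff i = 0 := fun i hi =>
    mulCoeff_eq_zero h2 h3 (by omega)
  ext m
  set I := Finset.Icc (m - 2 * N) N with hI
  set L := Finset.Icc (m - N) (2 * N) with hL
  have e1 : (A * B * C).coeff m = ∑ i ∈ I, ∑ j ∈ I, ∑ k ∈ I, ∑ l ∈ L,
      if m ≤ l + k ∧ l ≤ i + j then
        (fun p q : ℕ => (Ring.choose i p * Ring.choose (i + j - p) q) •
        (A.coeff i * (fun r : R => r′)^[p] (B.coeff j) * (fun r : R => r′)^[q] (C.coeff k)))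
          (i + j - l).toNat (l + k - m).toNat else 0 := by
    rw [mul_coeff, mulCoeff_eq_box h12 h3 (l := m - N) (l' := m - 2 * N) (by omega) (by omega)]
    have : ∀ l ∈ L, ∀ k ∈ I, mulTerm (A * B).coeff C.coeff m l k = ∑ i ∈ I, ∑ j ∈ I,
        if m ≤ l + k ∧ l ≤ i + j then
        (fun p q : ℕ => (Ring.choose i p * Ring.choose (i + j - p) q) •
        (A.coeff i * (fun r : R => r′)^[p] (B.coeff j) * (fun r : R => r′)^[q] (C.coeff k)))
          (i + j - l).toNat (l + k - m).toNat else 0 := by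
      intro l hl k hk
      unfold mulTerm
      split_ifs with hm
      · simp only [hL, Finset.mem_Icc] at hl
        rw [mul_coeff, mulCoeff_eq_box h1 h2 (l := m - 2 * N) (l' := m - 2 * N)
          (by omega) (by omega)]
        rw [Finset.sum_mul, Finset.smul_sum]
        refine Finset.sum_congr rfl fun i _ => ?_
        rw [Finset.sum_mul, Finset.smul_sum]
        refine Finset.sum_congr rfl fun j _ => ?_
        unfold mulTerm
        by_cases hij : l ≤ i + j
        · have : i + j - ((i + j - l).toNat : ℤ) = l := by omega
          simp only [hm, hij, and_self, if_true, this]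
          simp only [zsmul_eq_mul]; push_cast; ring
        · simp [hij]
      · simp [hm]
    rw [Finset.sum_congr rfl fun l hl => Finset.sum_congr rfl fun k hk => this l hl k hk]
    rw [Finset.sum_comm]
    simp only [Finset.sum_comm (s := L)]
    rw [Finset.sum_comm]
    refine Finset.sum_congr rfl fun i _ => ?_
    rw [Finset.sum_comm]
  have e2 : (A * (B * C)).coeff m = ∑ i ∈ I, ∑ j ∈ I, ∑ k ∈ I, ∑ l ∈ L,
      if m ≤ l + i ∧ l ≤ j + k then
        (fun r s : ℕ => (Ring.choose i s * Ring.choose j r) •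
        (A.coeff i * (fun r : R => r′)^[s] (B.coeff j * (fun r : R => r′)^[r] (C.coeff k))))
          (j + k - l).toNat (l + i - m).toNat else 0 := by
    rw [mul_coeff, mulCoeff_eq_box h1 h23 (l := m - 2 * N) (l' := m - N) (by omega) (by omega)]
    refine Finset.sum_congr rfl fun i _ => ?_
    have : ∀ l ∈ L, mulTerm A.coeff (B * C).coeff m i l = ∑ j ∈ I, ∑ k ∈ I,
        if m ≤ l + i ∧ l ≤ j + k then
        (fun r s : ℕ => (Ring.choose i s * Ring.choose j r) •
        (A.coeff i * (fun r : R => r′)^[s] (B.coeff j * (fun r : R => r′)^[r] (C.coeff k))))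
          (j + k - l).toNat (l + i - m).toNat else 0 := by
      intro l hl
      unfold mulTerm
      rw [add_comm i l]
      split_ifs with hm
      · simp only [hL, Finset.mem_Icc] at hl
        rw [mul_coeff, mulCoeff_eq_box h2 h3 (l := m - 2 * N) (l' := m - 2 * N)
          (by omega) (by omega)]
        change _ • (_ * iterHom _ _) = _
        rw [map_sum, Finset.mul_sum, Finset.smul_sum]
        refine Finset.sum_congr rfl fun j _ => ?_
        rw [map_sum, Finset.mul_sum, Finset.smul_sum]
        refine Finset.sum_congr rfl fun k _ => ?_
        unfold mulTerm
        by_cases hij : l ≤ j + k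
        · simp only [hm, hij, and_self, if_true, map_zsmul]
          change _ • (_ * _ • (fun r : R => r′)^[_] _) = _
          simp only [zsmul_eq_mul]; push_cast; ring
        · simp [hij]
      · simp [hm]
    rw [Finset.sum_congr rfl this]
    rw [Finset.sum_comm]
    refine Finset.sum_congr rfl fun j _ => ?_
    rw [Finset.sum_comm]
  rw [e1, e2]
  refine Finset.sum_congr rfl fun i hi => Finset.sum_congr rfl fun j hj =>
    Finset.sum_congr rfl fun k hk => ?_
  simp only [hI, Finset.mem_Icc] at hi hj hk
  have s1 := sum_window (fun p q : ℕ => (Ring.choose i p * Ring.choose (i + j - p) q) •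
    (A.coeff i * (fun r : R => r′)^[p] (B.coeff j) * (fun r : R => r′)^[q] (C.coeff k)))
    L (i + j) k m (i + j + k - m) (by ring)
    (by intro l _ _; simp only [hL, Finset.mem_Icc]; omega)
  have s2 := sum_window (fun r s : ℕ => (Ring.choose i s * Ring.choose j r) •
    (A.coeff i * (fun r : R => r′)^[s] (B.coeff j * (fun r : R => r′)^[r] (C.coeff k))))
    L (j + k) i m (i + j + k - m) (by ring)
    (by intro l _ _; simp only [hL, Finset.mem_Icc]; omega)
  refine s1.trans (Eq.trans ?_ s2.symm)
  split_ifs with hw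
  · rw [mono_assoc, ← Finset.Nat.sum_antidiagonal_swap]
    rfl
  · rfl

theorem mul_coeff_box {A B : PsiDO R} {N m : ℤ} (hA : ∀ i, N < i → A.coeff i = 0)
    (hB : ∀ i, N < i → B.coeff i = 0) : (A * B).coeff m =
      ∑ i ∈ Finset.Icc (m - N) N, ∑ j ∈ Finset.Icc (m - N) N, mulTerm A.coeff B.coeff m i j :=
  mulCoeff_eq_box hA hB le_rfl le_rfl

protected theorem left_distrib_aux (A B C : PsiDO R) : A * (B + C) = A * B + A * C := by
  obtain ⟨N, hA, hB, hC⟩ := exists_bdd₃ A B C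
  ext m
  rw [add_coeff, mul_coeff_box hA hB, mul_coeff_box hA hC, mul_coeff_box hA
    (fun i hi => by rw [add_coeff, hB i hi, hC i hi, add_zero])]
  simp only [← Finset.sum_add_distrib]
  refine Finset.sum_congr rfl fun i _ => Finset.sum_congr rfl fun j _ => ?_
  unfold mulTerm
  split_ifs
  · rw [add_coeff, iter_add, mul_add, smul_add]
  · rw [add_zero]

protected theorem right_distrib_aux (A B C : PsiDO R) : (A + B) * C = A * C + B * C := by
  obtain ⟨N, hA, hB, hC⟩ := exists_bdd₃ A B C
  ext m
  rw [add_coeff, mul_coeff_box hA hC, mul_coeff_box hB hC, mul_coeff_box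
    (fun i hi => by rw [add_coeff, hA i hi, hB i hi, add_zero]) hC]
  simp only [← Finset.sum_add_distrib]
  refine Finset.sum_congr rfl fun i _ => Finset.sum_congr rfl fun j _ => ?_
  unfold mulTerm
  split_ifs
  · rw [add_coeff, add_mul, smul_add]
  · rw [add_zero]

theorem monomial_zero_mul_coeff (a : R) (A : PsiDO R) (m : ℤ) :
    (monomial a 0 * A).coeff m = a * A.coeff m := by
  rw [mul_coeff, mulCoeff_eq_sum_of_ne {0} {m}]
  · simp [mulTerm, monomial_coeff]
  · intro i j h
    have hi : i = 0 := by
      by_contra hi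
      exact h (mulTerm_eq_zero (Or.inl (if_neg hi)))
    subst hi
    refine ⟨by simp, ?_⟩
    by_contra hj
    apply h
    unfold mulTerm
    split_ifs with hm
    · have : 0 < (0 + j - m).toNat := by simp at hj; omega
      rw [Ring.choose_zero_pos _ this, zero_smul]
    · rfl

theorem mul_monomial_zero_coeff {c : R} (hc : c′ = 0) (A : PsiDO R) (m : ℤ) :
    (A * monomial c 0).coeff m = c * A.coeff m := by
  rw [mul_coeff, mulCoeff_eq_sum_of_ne {m} {0}]
  · simp [mulTerm, monomial_coeff, mul_comm]
  · intro i j h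
    have hj : j = 0 := by
      by_contra hj
      exact h (mulTerm_eq_zero (Or.inr (Or.inl (if_neg hj))))
    subst hj
    refine ⟨?_, by simp⟩
    by_contra hi
    apply h
    unfold mulTerm
    split_ifs with hm
    · obtain ⟨p, hp⟩ : ∃ p, (i + 0 - m).toNat = p + 1 :=
        ⟨(i + 0 - m).toNat - 1, by simp at hi; omega⟩
      rw [hp, Function.iterate_succ_apply, monomial_coeff, if_pos rfl]
      rw [hc, iter_zero, mul_zero, smul_zero]
    · rfl

noncomputable instance : Ring (PsiDO R) where
  add_assoc A B C := by ext; simp [add_assoc]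
  zero_add A := by ext; simp
  add_zero A := by ext; simp
  add_comm A B := by ext; simp [add_comm]
  neg_add_cancel A := by ext; simp
  left_distrib := PsiDO.left_distrib_aux
  right_distrib := PsiDO.right_distrib_aux
  mul_assoc := PsiDO.mul_assoc_aux
  zero_mul A := by
    ext m
    rw [mul_coeff, mulCoeff_eq_sum_of_ne ∅ ∅ fun i j h => (h (mulTerm_eq_zero (Or.inl (zero_coeff i)))).elim]
    simp
  mul_zero A := by
    ext m
    rw [mul_coeff, mulCoeff_eq_sum_of_ne ∅ ∅
      fun i j h => (h (mulTerm_eq_zero (Or.inr (Or.inl (zero_coeff j))))).elim]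
    simp
  one_mul A := by ext m; exact (monomial_zero_mul_coeff 1 A m).trans (one_mul _)
  mul_one A := by
    ext m
    exact (mul_monomial_zero_coeff (Derivation.map_one_eq_zero _) A m).trans (one_mul _)
  nsmul := nsmulRec
  zsmul := zsmulRec

@[simp] theorem sub_coeff (A B : PsiDO R) (i : ℤ) : (A - B).coeff i = A.coeff i - B.coeff i := by
  rw [sub_eq_add_neg, add_coeff, neg_coeff, sub_eq_add_neg]

/-- The top coefficient of a product is the product of the top coefficients. -/
theorem mul_coeff_top {A B : PsiDO R} {N M : ℤ} (hA : ∀ i, N < i → A.coeff i = 0)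
    (hB : ∀ i, M < i → B.coeff i = 0) : (A * B).coeff (N + M) = A.coeff N * B.coeff M := by
  rw [mul_coeff, mulCoeff_eq_box hA hB (l := N) (l' := M) (by omega) (by omega)]
  simp [mulTerm]

theorem mul_coeff_eq_zero {A B : PsiDO R} {N M : ℤ} (hA : ∀ i, N < i → A.coeff i = 0)
    (hB : ∀ i, M < i → B.coeff i = 0) (i : ℤ) (hi : N + M < i) : (A * B).coeff i = 0 :=
  mulCoeff_eq_zero hA hB hi

theorem IsMonicOfOrder.mul {A B : PsiDO R} {n m : ℤ} (hA : A.IsMonicOfOrder n)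
    (hB : B.IsMonicOfOrder m) : (A * B).IsMonicOfOrder (n + m) :=
  ⟨by rw [mul_coeff_top hA.2 hB.2, hA.1, hB.1, one_mul], mul_coeff_eq_zero hA.2 hB.2⟩

theorem IsMonicOfOrder.pow {A : PsiDO R} (hA : A.IsMonicOfOrder 1) (n : ℕ) :
    (A ^ n).IsMonicOfOrder n := by
  induction n with
  | zero => simpa using isMonicOfOrder_one
  | succ n ih => rw [pow_succ]; push_cast; exact ih.mul hA

theorem perturb_pow {Q E : PsiDO R} (hQ : Q.IsMonicOfOrder 1) (k : ℕ)
    (hE : ∀ i, -(k : ℤ) < i → E.coeff i = 0) (n : ℕ) :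
    (∀ i, (n : ℤ) - 1 - k < i → ((Q + E) ^ n - Q ^ n).coeff i = 0) ∧
      ((Q + E) ^ n - Q ^ n).coeff ((n : ℤ) - 1 - k) = n * E.coeff (-k) := by
  induction n with
  | zero => simp
  | succ n ih =>
    have e : (Q + E) ^ (n + 1) - Q ^ (n + 1) = ((Q + E) ^ n - Q ^ n) * (Q + E) + Q ^ n * E := by
      rw [pow_succ, pow_succ]; noncomm_ring
    have hQE : (Q + E).IsMonicOfOrder 1 :=
      ⟨by rw [add_coeff, hQ.1, hE 1 (by omega), add_zero],
        fun i hi => by rw [add_coeff, hQ.2 i hi, hE i (by omega), add_zero]⟩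
    have hn := hQ.pow n
    rw [e]
    constructor
    · intro i hi
      push_cast at hi
      rw [add_coeff, mul_coeff_eq_zero ih.1 hQE.2 i (by omega),
        mul_coeff_eq_zero hn.2 hE i (by omega), add_zero]
    · have h1 := mul_coeff_top ih.1 hQE.2
      have h2 := mul_coeff_top hn.2 hE
      rw [show ((n : ℤ) - 1 - k) + 1 = ((n + 1 : ℕ) : ℤ) - 1 - k by push_cast; ring, ih.2,
        hQE.1] at h1
      rw [show (n : ℤ) + -k = ((n + 1 : ℕ) : ℤ) - 1 - k by push_cast; ring, hn.1] at h2
      rw [add_coeff, h1, h2]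
      push_cast; ring

open Classical in
/-- The unique monic `n`-th root `A^{1/n}` (of order `1`) of an operator `A` that is monic of
order `n`; see `existsUnique_root` (and `0` if there is none). -/
noncomputable def nthRoot (n : ℕ) (A : PsiDO R) : PsiDO R :=
  if h : ∃ Q : PsiDO R, Q.IsMonicOfOrder 1 ∧ Q ^ n = A then h.choose else 0

theorem existsUnique_root {n : ℕ} (hn : IsUnit (n : R)) {A : PsiDO R}
    (hA : A.IsMonicOfOrder n) : ∃! Q : PsiDO R, Q.IsMonicOfOrder 1 ∧ Q ^ n = A := by
  obtain ⟨u, hu⟩ := hn.exists_right_inv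
  refine existsUnique_of_exists_of_unique ?_ ?_
  · let q : ℕ → PsiDO R := fun k => Nat.rec (monomial 1 1) (fun k Q =>
      Q + monomial (u * (A - Q ^ n).coeff ((n : ℤ) - 1 - k)) (-(k : ℤ))) k
    have hq (k : ℕ) : q (k + 1) =
      q k + monomial (u * (A - q k ^ n).coeff ((n : ℤ) - 1 - k)) (-(k : ℤ)) := rfl
    have hmono (k : ℕ) : (q k).IsMonicOfOrder 1 := by
      induction k with
      | zero =>
        change (monomial 1 1 : PsiDO R).IsMonicOfOrder 1
        exact ⟨by simp [monomial_coeff], fun i hi => by rw [monomial_coeff, if_neg (by omega)]⟩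
      | succ k ih =>
        rw [hq]
        exact ⟨by rw [add_coeff, ih.1, monomial_coeff, if_neg (by omega), add_zero],
          fun i hi => by rw [add_coeff, ih.2 i hi, monomial_coeff, if_neg (by omega), add_zero]⟩
    have happ (k : ℕ) : ∀ i, (n : ℤ) - 1 - k < i → (q k ^ n).coeff i = A.coeff i := by
      induction k with
      | zero =>
        intro i hi
        have h := (hmono 0).pow n
        rcases eq_or_lt_of_le (show (n : ℤ) ≤ i by simp at hi; omega) with rfl | hi'
        · rw [h.1, hA.1]
        · rw [h.2 i hi', hA.2 i hi']
      | succ k ih =>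
        intro i hi
        push_cast at hi
        have h := perturb_pow (hmono k) k (E := monomial (u * (A - q k ^ n).coeff
          ((n : ℤ) - 1 - k)) (-(k : ℤ))) (fun i hi => if_neg (by omega)) n
        rw [← hq] at h
        rcases eq_or_lt_of_le (show (n : ℤ) - 1 - k ≤ i by omega) with rfl | hi'
        · have h2 := h.2
          rw [monomial_coeff, if_pos rfl, ← mul_assoc, hu, one_mul, sub_coeff, sub_coeff] at h2
          simpa using h2
        · have h1 := h.1 i hi'
          rw [sub_coeff, ih i hi', sub_eq_zero] at h1
          exact h1
    have hstab (i : ℤ) (m : ℕ) (hm : (1 - i).toNat ≤ m) :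
        (q m).coeff i = (q (1 - i).toNat).coeff i := by
      induction m, hm using Nat.le_induction with
      | base => rfl
      | succ m hm ih => rw [hq, add_coeff, ih, monomial_coeff, if_neg (by omega), add_zero]
    let Q : PsiDO R := ⟨fun i => (q (1 - i).toNat).coeff i, 1, fun i hi => (hmono _).2 i hi⟩
    have hQc (i : ℤ) : Q.coeff i = (q (1 - i).toNat).coeff i := rfl
    refine ⟨Q, ⟨by simpa [hQc] using (hmono 0).1, fun i hi => by rw [hQc]; exact (hmono _).2 i hi⟩, ?_⟩
    ext i
    obtain ⟨m, hm⟩ : ∃ m : ℕ, (n : ℤ) - 1 - m < i := ⟨((n : ℤ) - i).toNat, by omega⟩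
    have h := (perturb_pow (hmono m) m (E := Q - q m) (fun i hi => by
      rw [sub_coeff, hstab i m (by omega), sub_self]) n).1 i hm
    rw [add_sub_cancel, sub_coeff, sub_eq_zero] at h
    rw [h, happ m i hm]
  · rintro Q Q' ⟨hQ, hQA⟩ ⟨hQ', hQA'⟩
    have key (k : ℕ) : ∀ i, -(k : ℤ) < i → (Q' - Q).coeff i = 0 := by
      induction k with
      | zero =>
        intro i hi
        rcases eq_or_lt_of_le (show (1 : ℤ) ≤ i by simp at hi; omega) with rfl | hi'
        · rw [sub_coeff, hQ.1, hQ'.1, sub_self]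
        · rw [sub_coeff, hQ.2 i hi', hQ'.2 i hi', sub_self]
      | succ k ih =>
        intro i hi
        push_cast at hi
        rcases eq_or_lt_of_le (show -(k : ℤ) ≤ i by omega) with rfl | hi'
        · have h := (perturb_pow hQ k ih n).2
          rw [add_sub_cancel, hQA, hQA', sub_self, zero_coeff] at h
          have h2 : u * (n * (Q' - Q).coeff (-k)) = 0 := by rw [← h, mul_zero]
          rwa [← mul_assoc, mul_comm u, hu, one_mul] at h2
        · exact ih i hi'
    ext i
    have h := key (1 - i).toNat i (by omega)
    rw [sub_coeff, sub_eq_zero] at h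
    exact h.symm

theorem nthRoot_spec {n : ℕ} (hn : IsUnit (n : R)) {A : PsiDO R} (hA : A.IsMonicOfOrder n) :
    (nthRoot n A).IsMonicOfOrder 1 ∧ nthRoot n A ^ n = A := by
  have h := (existsUnique_root hn hA).exists
  rw [nthRoot, dif_pos h]
  exact h.choose_spec

end Ring

/-- Apply a ring homomorphism to all coefficients. -/
def map {R S : Type*} [CommRing R] [CommRing S] (f : R →+* S) (A : PsiDO R) : PsiDO S :=
  ⟨fun i => f (A.coeff i), by
    obtain ⟨N, hN⟩ := A.bdd
    exact ⟨N, fun i hi => by rw [hN i hi, map_zero]⟩⟩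

open Classical in
/-- The order of an operator: the largest `i` such that the coefficient of `∂^i` is nonzero, and
`-∞` for the zero operator. -/
noncomputable def ord {R : Type*} [CommRing R] (A : PsiDO R) : WithBot ℤ :=
  if A = 0 then ⊥ else ((sSup {i : ℤ | A.coeff i ≠ 0} : ℤ) : WithBot ℤ)

theorem ord_le_iff {R : Type*} [CommRing R] (A : PsiDO R) (m : ℤ) :
    A.ord ≤ m ↔ ∀ i, m < i → A.coeff i = 0 := by
  unfold ord
  split_ifs with h
  · subst h; simp
  · obtain ⟨N, hN⟩ := A.bdd
    have hb : BddAbove {i : ℤ | A.coeff i ≠ 0} := ⟨N, fun i hi => by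
      by_contra! h'
      exact hi (hN i h')⟩
    have hne : {i : ℤ | A.coeff i ≠ 0}.Nonempty := by
      by_contra hc
      rw [Set.not_nonempty_iff_eq_empty, Set.eq_empty_iff_forall_notMem] at hc
      exact h (by ext i; simpa using hc i)
    rw [WithBot.coe_le_coe, csSup_le_iff hb hne]
    refine ⟨fun H i hi => ?_, fun H i hi => ?_⟩
    · by_contra hc
      exact absurd (H i hc) (by omega)
    · by_contra! hc
      exact hi (H i hc)

end PsiDO

section DifferentialOperators

variable {R : Type*} [CommRing R] [Differential R]

variable (R) in
/-- The ring of constants of a differential ring (a field if `R` is a field). -/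
def constantRing : Subring R where
  carrier := {c | c′ = 0}
  mul_mem' {a b} ha hb := by simp_all
  one_mem' := by simp
  add_mem' {a b} ha hb := by simp_all
  zero_mem' := by simp
  neg_mem' {a} ha := by simp_all

noncomputable instance : Algebra (constantRing R) (PsiDO R) where
  smul c A := ⟨fun i => c * A.coeff i, by
    obtain ⟨N, hN⟩ := A.bdd
    exact ⟨N, fun i hi => by rw [hN i hi, mul_zero]⟩⟩
  algebraMap :=
    { toFun := fun c => PsiDO.monomial c 0
      map_one' := rfl
      map_mul' := fun a b => by
        ext m
        rw [PsiDO.monomial_zero_mul_coeff]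
        simp [PsiDO.monomial_coeff]
      map_zero' := by ext m; simp [PsiDO.monomial_coeff]
      map_add' := fun a b => by
        ext m
        simp only [PsiDO.monomial_coeff, PsiDO.add_coeff]
        split_ifs <;> simp }
  commutes' c A := by
    ext m
    exact (PsiDO.monomial_zero_mul_coeff _ A m).trans (PsiDO.mul_monomial_zero_coeff c.2 A m).symm
  smul_def' c A := by
    ext m
    exact (PsiDO.monomial_zero_mul_coeff _ A m).symm

theorem PsiDO.smul_coeff (c : constantRing R) (A : PsiDO R) (i : ℤ) :
    (c • A).coeff i = c * A.coeff i := rfl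

variable (R) in
/-- The ring `R[∂]` of differential operators: the pseudo-differential operators without negative
powers of `∂`. -/
noncomputable def diffOpSubalgebra : Subalgebra (constantRing R) (PsiDO R) where
  carrier := {A | ∀ i < 0, A.coeff i = 0}
  mul_mem' {A B} hA hB := by
    intro m hm
    rw [PsiDO.mul_coeff, PsiDO.mulCoeff_eq_sum_of_ne ∅ ∅]
    · simp
    intro i j h
    exfalso
    apply h
    rcases lt_or_ge i 0 with hi | hi
    · exact PsiDO.mulTerm_eq_zero (Or.inl (hA i hi))
    rcases lt_or_ge j 0 with hj | hj
    · exact PsiDO.mulTerm_eq_zero (Or.inr (Or.inl (hB j hj)))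
    unfold PsiDO.mulTerm
    split_ifs with hij
    · obtain ⟨p, rfl⟩ := Int.eq_ofNat_of_zero_le hi
      have : p < ((p : ℤ) + j - m).toNat := by omega
      rw [Ring.choose_natCast, Nat.choose_eq_zero_of_lt this]
      simp
    · rfl
  add_mem' {A B} hA hB i hi := by rw [PsiDO.add_coeff, hA i hi, hB i hi, add_zero]
  algebraMap_mem' c i hi := if_neg (by omega)

variable (R) in
/-- The type of differential operators `R[∂]`. -/
def DiffOp : Type _ := ↥(diffOpSubalgebra R)

noncomputable instance : Ring (DiffOp R) := inferInstanceAs (Ring ↥(diffOpSubalgebra R))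

noncomputable instance : Algebra (constantRing R) (DiffOp R) :=
  inferInstanceAs (Algebra (constantRing R) ↥(diffOpSubalgebra R))

namespace DiffOp

/-- A differential operator as a pseudo-differential operator. -/
def toPsiDO (A : DiffOp R) : PsiDO R := A.1

instance : Coe (DiffOp R) (PsiDO R) := ⟨toPsiDO⟩

/-- The coefficient of `∂^i`. -/
def coeff (A : DiffOp R) (i : ℕ) : R := (A : PsiDO R).coeff i

/-- The order (`⊥` for the zero operator). -/
noncomputable def ord (A : DiffOp R) : WithBot ℤ := (A : PsiDO R).ord

/-- `L = ∂^n + υ_2 ∂^{n-2} + ⋯ + υ_n`. -/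
def IsNormalForm (n : ℕ) (L : DiffOp R) : Prop :=
  (L : PsiDO R).IsMonicOfOrder n ∧ (L : PsiDO R).coeff ((n : ℤ) - 1) = 0

end DiffOp

/-- The positive part `A_+`. -/
noncomputable def PsiDO.posPart (A : PsiDO R) : DiffOp R :=
  ⟨⟨fun i => if 0 ≤ i then A.coeff i else 0, by
    obtain ⟨N, hN⟩ := A.bdd
    exact ⟨N, fun i hi => by rw [hN i hi, ite_self]⟩⟩, fun i hi => if_neg (by omega)⟩

end DifferentialOperators

/-! ### Differential polynomials and the Gelfand-Dickey hierarchy -/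

section Hierarchy

/-- The ring `C{u_2, …, u_n}` of differential polynomials over a ring `C` of constants; the
variable `(ℓ, k)` is `u_ℓ^{(k)}`. -/
def DiffPoly (C : Type*) [CommRing C] (n : ℕ) : Type _ :=
  MvPolynomial ({ℓ : ℕ // 2 ≤ ℓ ∧ ℓ ≤ n} × ℕ) C

variable (C : Type*) [CommRing C] (n : ℕ)

noncomputable instance : CommRing (DiffPoly C n) :=
  inferInstanceAs (CommRing (MvPolynomial ({ℓ : ℕ // 2 ≤ ℓ ∧ ℓ ≤ n} × ℕ) C))

noncomputable instance : Algebra C (DiffPoly C n) :=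
  inferInstanceAs (Algebra C (MvPolynomial ({ℓ : ℕ // 2 ≤ ℓ ∧ ℓ ≤ n} × ℕ) C))

/-- The variable `u_ℓ^{(k)}`. -/
noncomputable def DiffPoly.u (ℓ : {ℓ : ℕ // 2 ≤ ℓ ∧ ℓ ≤ n}) (k : ℕ) : DiffPoly C n :=
  MvPolynomial.X (ℓ, k)

/-- The derivation with `∂ c = 0` for `c` in `C` and `∂ u_ℓ^{(k)} = u_ℓ^{(k+1)}`. -/
noncomputable def DiffPoly.derivation : Derivation C (DiffPoly C n) (DiffPoly C n) :=
  (MvPolynomial.mkDerivation C fun x : {ℓ : ℕ // 2 ≤ ℓ ∧ ℓ ≤ n} × ℕ =>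
    (MvPolynomial.X (x.1, x.2 + 1) : MvPolynomial ({ℓ : ℕ // 2 ≤ ℓ ∧ ℓ ≤ n} × ℕ) C) :)

noncomputable instance : Differential (DiffPoly C n) :=
  ⟨(DiffPoly.derivation C n).restrictScalars ℤ⟩

/-- The formal operator `L_n = ∂^n + u_2 ∂^{n-2} + ⋯ + u_{n-1} ∂ + u_n`. -/
noncomputable def formalOp : DiffOp (DiffPoly C n) :=
  ⟨⟨fun i => if i = n then 1 else
      if h : 2 ≤ ((n : ℤ) - i).toNat ∧ ((n : ℤ) - i).toNat ≤ n then
        DiffPoly.u C n ⟨((n : ℤ) - i).toNat, h⟩ 0 else 0,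
    n, fun i hi => by rw [if_neg (by omega), dif_neg (by omega)]⟩,
    fun i hi => by
      change (if i = n then _ else _) = _
      rw [if_neg (by omega), dif_neg (by omega)]⟩

/-- The homogeneous basis `P_m = ((L_n)^{m/n})_+` of the operators almost commuting with `L_n`. -/
noncomputable def homogeneousOp (m : ℕ) : DiffOp (DiffPoly C n) :=
  (PsiDO.nthRoot n (formalOp C n : PsiDO (DiffPoly C n)) ^ m).posPart

/-- `H_{k,m}`: the coefficient of `∂^k` in `[P_m, L_n]`. -/
noncomputable def hierarchyCoeff (k m : ℕ) : DiffPoly C n :=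
  (homogeneousOp C n m * formalOp C n - formalOp C n * homogeneousOp C n m).coeff k

theorem formalOp_monic (C : Type*) [CommRing C] (n : ℕ) :
    (formalOp C n : PsiDO (DiffPoly C n)).IsMonicOfOrder n :=
  ⟨if_pos rfl, fun i hi => by
    change (if i = n then _ else _) = _
    rw [if_neg (by omega), dif_neg (by omega)]⟩

theorem isUnit_natCast_diffPoly {K : Type*} [Field K] [CharZero K] [Differential K] (n : ℕ) (hn : 1 ≤ n) (m : ℕ) :
    IsUnit (n : DiffPoly (constantRing K) m) := by
  have hK : (n : K) ≠ 0 := by exact_mod_cast (by omega : n ≠ 0)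
  let v : constantRing K := ⟨(n : K)⁻¹, by
    change ((n : K)⁻¹)′ = 0
    rw [Derivation.leibniz_inv]; simp⟩
  have hv : (n : constantRing K) * v = 1 := by
    apply Subtype.ext
    simp [v, hK]
  have : IsUnit (n : constantRing K) := IsUnit.of_mul_eq_one _ hv
  simpa using this.map (algebraMap (constantRing K) (DiffPoly (constantRing K) m))

/-- In characteristic zero the root of `L_n` that defines the homogeneous basis exists. -/
theorem nthRoot_formalOp_spec {K : Type*} [Field K] [CharZero K] [Differential K] (n : ℕ)
    (hn : 1 ≤ n) :
    (PsiDO.nthRoot n (formalOp (constantRing K) n).toPsiDO).IsMonicOfOrder 1 ∧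
      PsiDO.nthRoot n (formalOp (constantRing K) n).toPsiDO ^ n =
        (formalOp (constantRing K) n).toPsiDO :=
  PsiDO.nthRoot_spec (isUnit_natCast_diffPoly (K := K) n hn n) (formalOp_monic (constantRing K) n)

end Hierarchy

section Specialization

variable {K : Type*} [Field K] [Differential K]

/-- The specialization `C{u_2, …, u_n} → K` at the coefficients of `L`: it sends `u_ℓ^{(k)}` to the
`k`-th derivative of `υ_ℓ`, the coefficient of `∂^{n-ℓ}` in `L`. -/
noncomputable def specialize (n : ℕ) (L : DiffOp K) :
    DiffPoly (constantRing K) n →ₐ[constantRing K] K :=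
  (MvPolynomial.aeval fun x => (fun a : K => a′)^[x.2] (L.coeff (n - x.1)) :
    MvPolynomial ({ℓ : ℕ // 2 ≤ ℓ ∧ ℓ ≤ n} × ℕ) (constantRing K) →ₐ[constantRing K] K)

/-- `B_j`, the specialization of `P_j` at `L`. -/
noncomputable def almostCommutingOp (n : ℕ) (L : DiffOp K) (j : ℕ) : DiffOp K :=
  ⟨(homogeneousOp (constantRing K) n j : PsiDO _).map (specialize n L).toRingHom, fun i hi => by
    exact (congrArg (specialize n L) ((homogeneousOp (constantRing K) n j).2 i hi)).trans
      (map_zero _)⟩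

/-- `σ_{k,j}`, the specialization of `H_{k,j}` at `L`. -/
noncomputable def gdCoeff (n : ℕ) (L : DiffOp K) (k j : ℕ) : K :=
  specialize n L (hierarchyCoeff (constantRing K) n k j)

/-- The constant vector `c` (indexed by a finite set `J` of indices `< m`) solves the linear system
`σ_{k,m} + ∑_{j ∈ J} c_j σ_{k,j} = 0`, `k = 0, …, n-2`. -/
def IsGDSolution (n : ℕ) (L : DiffOp K) (m : ℕ) (J : Finset ℕ) (c : J → constantRing K) : Prop :=
  ∀ k : ℕ, k + 2 ≤ n → gdCoeff n L k m + ∑ j : J, (c j : K) * gdCoeff n L k j = 0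

open Classical in
/-- The index set of the optimized system: all `j < m` that are not of the form `M_k + h n` with
`h ≥ 0` and `M_k < m`. -/
noncomputable def optimizedIndices (n : ℕ) {d : ℕ} (M : Fin d → ℕ) (m : ℕ) : Finset ℕ :=
  (Finset.range m).filter fun j => ∀ k, M k < m → ∀ h : ℕ, j ≠ M k + h * n

/-- The centralizer `Z(L)` in `K[∂]`. -/
noncomputable def centralizer (L : DiffOp K) : Subalgebra (constantRing K) (DiffOp K) :=
  Subalgebra.centralizer (constantRing K) {L}

/-- `C[L]`. -/
noncomputable def polyRing (L : DiffOp K) : Subalgebra (constantRing K) (DiffOp K) :=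
  Algebra.adjoin (constantRing K) {L}

theorem polyRing_le_centralizer (L : DiffOp K) : polyRing L ≤ centralizer L := by
  refine Algebra.adjoin_le ?_
  rintro _ rfl
  exact Subalgebra.mem_centralizer_iff _ |>.2 (by rintro _ rfl; rfl)

/-- `Z(L)` as a `C[L]`-module. -/
noncomputable def centralizerModule (L : DiffOp K) : Submodule (polyRing L) (DiffOp K) where
  carrier := centralizer L
  add_mem' := add_mem
  zero_mem' := zero_mem _
  smul_mem' p _ hA := mul_mem (polyRing_le_centralizer L p.2) hA

/-- `Z_m(L)`: the elements of `Z(L)` of order at most `m`. -/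
noncomputable def filteredCentralizer (L : DiffOp K) (m : ℤ) :
    Submodule (constantRing K) (DiffOp K) where
  carrier := {A | A ∈ centralizer L ∧ A.ord ≤ m}
  add_mem' {A B} hA hB := ⟨add_mem hA.1 hB.1, (PsiDO.ord_le_iff _ _).2 fun i hi => by
    change A.toPsiDO.coeff i + B.toPsiDO.coeff i = 0
    rw [(PsiDO.ord_le_iff _ _).1 hA.2 i hi, (PsiDO.ord_le_iff _ _).1 hB.2 i hi, add_zero]⟩
  zero_mem' := ⟨zero_mem _, (PsiDO.ord_le_iff _ _).2 fun i _ => rfl⟩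
  smul_mem' c A hA := ⟨Subalgebra.smul_mem _ hA.1 c, (PsiDO.ord_le_iff _ _).2 fun i hi => by
    change (c : K) * A.toPsiDO.coeff i = 0
    rw [(PsiDO.ord_le_iff _ _).1 hA.2 i hi, mul_zero]⟩

/-- The set `O` of classes modulo `n` of the orders of the nonzero elements of `Z(L)`. -/
def orderClasses (n : ℕ) (L : DiffOp K) : Set (ZMod n) :=
  {x | ∃ Q ∈ centralizer L, ∃ m : ℤ, Q.ord = m ∧ x = m}

end Specialization

/-! Write `S` for the set of orders of nonzero elements of Z(L). If [A, L] has order at most n - 2,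
then the leading coefficient a of A is constant: for A of order m, the coefficient of ∂^{m+n-1} in
[A, L] is -n a', and n is invertible. The operators B_j = (R^j)_+, where R is an n-th root of L,
have this property and are monic of order j, since [B_j, L] = -[(R^j)_-, L] with (R^j)_- of negative
order. All such A can therefore be divided by the B_j with constant coefficients, and a combination
of the B_j commutes with L exactly when the n - 1 equations of the Gelfand-Dickey system hold.

Existence. Multiplication by L shows that `S` + n ⊆ `S`, so `S` is the union of the progressions M_i
+ nℕ, where the M_i are the least elements of `S` in their classes modulo n. The index set of the
optimized system at M_i is then the set of gaps of `S` below M_i. Reducing B_{M_i} along the orders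
in `S` modulo Z(L) leaves a combination indexed by gaps, which is a solution. It is unique, because
a combination of the B_j over gaps that lies in Z(L) has its order in `S` unless it vanishes. The
resulting G_i are independent over C[L], since the orders of the p_i G_i are distinct modulo n, and
they span by division by the L^h G_i.

Uniqueness. For a competing basis the orders are not known in advance to be distinct modulo n; this
comes from the uniqueness of the solutions. If M_k ≡ M_i with k < i, reduce B_{M_i} modulo the
C[L]-span V of the basis elements before the i-th, which contains some L^h G_k of order M_i. The
outcome is a solution whose operator lies in V, hence equals G_i, contradicting independence. Orders
distinct modulo n must be the minimal ones, so the M_i, the systems and their solutions all agree.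
-/

namespace PsiDO

/-! ### Change of coefficients along differential homomorphisms -/

section Map

variable {R S : Type*} [CommRing R] [CommRing S]

@[simp] theorem map_coeff (f : R →+* S) (A : PsiDO R) (i : ℤ) :
    (A.map f).coeff i = f (A.coeff i) := rfl

theorem IsMonicOfOrder.map {A : PsiDO R} {n : ℤ} (hA : A.IsMonicOfOrder n) (f : R →+* S) :
    (A.map f).IsMonicOfOrder n :=
  ⟨by rw [map_coeff, hA.1, map_one], fun i hi => by rw [map_coeff, hA.2 i hi, map_zero]⟩

theorem map_one (f : R →+* S) : (1 : PsiDO R).map f = 1 := by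
  ext i
  rw [map_coeff, one_coeff, one_coeff]
  split_ifs <;> simp

variable [Differential R] [Differential S]

theorem map_sub (f : R →+* S) (A B : PsiDO R) : (A - B).map f = A.map f - B.map f := by
  ext i
  simp

theorem map_iterate_deriv {f : R →+* S} (hf : ∀ r, f (r′) = (f r)′) (p : ℕ) (r : R) :
    f ((fun r : R => r′)^[p] r) = (fun s : S => s′)^[p] (f r) := by
  induction p with
  | zero => rfl
  | succ p ih => rw [Function.iterate_succ_apply', Function.iterate_succ_apply', hf, ih]

theorem map_mul {f : R →+* S} (hf : ∀ r, f (r′) = (f r)′) (A B : PsiDO R) :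
    (A * B).map f = A.map f * B.map f := by
  obtain ⟨N, hA, hB, -⟩ := exists_bdd₃ A B 0
  ext m
  rw [map_coeff, mul_coeff_box hA hB, mul_coeff_box (N := N)
    (fun i hi => by rw [map_coeff, hA i hi, map_zero])
    (fun i hi => by rw [map_coeff, hB i hi, map_zero])]
  simp only [map_sum]
  refine Finset.sum_congr rfl fun i _ => Finset.sum_congr rfl fun j _ => ?_
  unfold mulTerm
  split_ifs
  · rw [map_zsmul, _root_.map_mul, map_iterate_deriv hf, map_coeff, map_coeff]
  · exact map_zero f

theorem map_pow {f : R →+* S} (hf : ∀ r, f (r′) = (f r)′) (A : PsiDO R) (k : ℕ) :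
    (A ^ k).map f = A.map f ^ k := by
  induction k with
  | zero => rw [pow_zero, pow_zero, map_one]
  | succ k ih => rw [pow_succ, pow_succ, map_mul hf, ih]

end Map

/-! ### The top coefficients of a commutator -/

section Commutator

variable {R : Type*} [CommRing R] [Differential R]

/-- Only the index pairs (N, M-1), (N-1, M) and (N, M) reach this degree; the last one does so
through one differentiation, with binomial factor `Ring.choose N 1 = N`. -/
theorem mul_coeff_top_sub_one {A B : PsiDO R} {N M : ℤ} (hA : ∀ i, N < i → A.coeff i = 0)
    (hB : ∀ i, M < i → B.coeff i = 0) : (A * B).coeff (N + M - 1) =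
      A.coeff N * B.coeff (M - 1) + A.coeff (N - 1) * B.coeff M
        + N * (A.coeff N * (B.coeff M)′) := by
  have e (k : ℤ) : Finset.Icc (k - 1) k = {k - 1, k} := by
    ext i; simp only [Finset.mem_Icc, Finset.mem_insert, Finset.mem_singleton]; omega
  rw [mul_coeff, mulCoeff_eq_box hA hB (l := N - 1) (l' := M - 1) (by omega) (by omega), e, e]
  rw [Finset.sum_pair (by omega), Finset.sum_pair (by omega), Finset.sum_pair (by omega)]
  unfold mulTerm
  rw [if_neg (by omega), if_pos (by omega), if_pos (by omega), if_pos (by omega)]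
  rw [show (N - 1 + M - (N + M - 1)).toNat = 0 by omega,
    show (N + (M - 1) - (N + M - 1)).toNat = 0 by omega,
    show (N + M - (N + M - 1)).toNat = 1 by omega]
  simp
  ring

/-- Coefficients commute, so the two leading products cancel and the commutator loses one order. -/
theorem commutator_coeff_eq_zero {A B : PsiDO R} {N M : ℤ} (hA : ∀ i, N < i → A.coeff i = 0)
    (hB : ∀ i, M < i → B.coeff i = 0) (i : ℤ) (hi : N + M - 1 < i) :
    (A * B - B * A).coeff i = 0 := by
  rcases eq_or_lt_of_le (show N + M ≤ i by omega) with rfl | hi'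
  · rw [sub_coeff, mul_coeff_top hA hB, add_comm N M, mul_coeff_top hB hA]; ring
  · rw [sub_coeff, mul_coeff_eq_zero hA hB i hi', mul_coeff_eq_zero hB hA i (by omega), sub_self]

/-- The terms without derivatives cancel, and the leading coefficient 1 of `B` has derivative zero,
so only the derivative of the leading coefficient of `A` survives. -/
theorem commutator_coeff_top {A B : PsiDO R} {N M : ℤ} (hA : ∀ i, N < i → A.coeff i = 0)
    (hB : B.IsMonicOfOrder M) :
    (A * B - B * A).coeff (N + M - 1) = -(M * (A.coeff N)′) := by
  rw [sub_coeff, mul_coeff_top_sub_one hA hB.2, add_comm N M, mul_coeff_top_sub_one hB.2 hA, hB.1]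
  simp
  ring

end Commutator

end PsiDO

/-! ### Specialization as a differential homomorphism -/

theorem DiffPoly.deriv_C {C : Type*} [CommRing C] {n : ℕ} (c : C) :
    (algebraMap C (DiffPoly C n) c)′ = 0 :=
  (DiffPoly.derivation C n).map_algebraMap c

theorem DiffPoly.deriv_u {C : Type*} [CommRing C] {n : ℕ} (ℓ : {ℓ : ℕ // 2 ≤ ℓ ∧ ℓ ≤ n}) (k : ℕ) :
    (DiffPoly.u C n ℓ k)′ = DiffPoly.u C n ℓ (k + 1) :=
  MvPolynomial.mkDerivation_X C
    (fun x : {ℓ : ℕ // 2 ≤ ℓ ∧ ℓ ≤ n} × ℕ =>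
      (MvPolynomial.X (x.1, x.2 + 1) : MvPolynomial ({ℓ : ℕ // 2 ≤ ℓ ∧ ℓ ≤ n} × ℕ) C)) (ℓ, k)

@[elab_as_elim]
theorem DiffPoly.induction_on {C : Type*} [CommRing C] {n : ℕ} {P : DiffPoly C n → Prop}
    (p : DiffPoly C n) (const : ∀ c, P (algebraMap C _ c))
    (add : ∀ p q, P p → P q → P (p + q)) (mul_u : ∀ p ℓ k, P p → P (p * DiffPoly.u C n ℓ k)) :
    P p :=
  MvPolynomial.induction_on p const add fun p x h => mul_u p x.1 x.2 h

section Specialization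

variable {K : Type*} [Field K] [Differential K] {n : ℕ} (L : DiffOp K)

theorem specialize_u (ℓ : {ℓ : ℕ // 2 ≤ ℓ ∧ ℓ ≤ n}) (k : ℕ) :
    specialize n L (DiffPoly.u _ n ℓ k) = (fun a : K => a′)^[k] (L.coeff (n - ℓ)) :=
  MvPolynomial.aeval_X _ _

theorem specialize_deriv (p : DiffPoly (constantRing K) n) :
    specialize n L (p′) = (specialize n L p)′ := by
  induction p using DiffPoly.induction_on with
  | const c =>
    rw [DiffPoly.deriv_C, map_zero, AlgHom.commutes]
    exact c.2.symm
  | add p q hp hq => rw [map_add, map_add, map_add, map_add, hp, hq]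
  | mul_u p ℓ k hp =>
    have hu : specialize n L ((DiffPoly.u _ n ℓ k)′) = (specialize n L (DiffPoly.u _ n ℓ k))′ := by
      rw [DiffPoly.deriv_u, specialize_u, specialize_u, Function.iterate_succ_apply']
    rw [map_mul (specialize n L) p, Derivation.leibniz, Derivation.leibniz, map_add, smul_eq_mul,
      smul_eq_mul, smul_eq_mul, smul_eq_mul, map_mul, map_mul, hp, hu]

variable {L}

/-- The normal form is what makes this true in degree n - 1, where the formal operator has no
variable. -/
theorem map_specialize_formalOp (hL : L.IsNormalForm n) :
    (formalOp (constantRing K) n).toPsiDO.map (specialize n L).toRingHom = L.toPsiDO := by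
  ext i
  rw [PsiDO.map_coeff]
  change specialize n L (if i = n then 1 else
      if h : 2 ≤ ((n : ℤ) - i).toNat ∧ ((n : ℤ) - i).toNat ≤ n then
        DiffPoly.u _ n ⟨((n : ℤ) - i).toNat, h⟩ 0 else 0) = _
  split_ifs with h1 h2
  · rw [h1, hL.1.1, map_one]
  · rw [specialize_u, Function.iterate_zero_apply]
    change L.toPsiDO.coeff ((n - ((n : ℤ) - i).toNat : ℕ) : ℤ) = _
    congr 1
    omega
  · rw [map_zero]
    rcases lt_or_ge i 0 with hi | hi
    · exact (L.2 i hi).symm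
    rcases lt_or_ge (n : ℤ) i with hi' | hi'
    · exact (hL.1.2 i hi').symm
    rw [show i = (n : ℤ) - 1 by omega, hL.2]

variable (n L) in
-- Since specialization respects derivations, it carries products of operators to products; the
-- specialized commutator is thus the commutator of the specialized operators.
theorem gdCoeff_eq (hL : L.IsNormalForm n) (k j : ℕ) :
    gdCoeff n L k j =
      (almostCommutingOp n L j * L - L * almostCommutingOp n L j).toPsiDO.coeff k := by
  have h := specialize_deriv (n := n) L
  have e : (almostCommutingOp n L j * L - L * almostCommutingOp n L j).toPsiDO =
      ((homogeneousOp (constantRing K) n j * formalOp _ n -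
        formalOp _ n * homogeneousOp _ n j).toPsiDO).map (specialize n L).toRingHom := by
    change _ = ((homogeneousOp (constantRing K) n j).toPsiDO * (formalOp _ n).toPsiDO -
        (formalOp _ n).toPsiDO * (homogeneousOp _ n j).toPsiDO).map _
    rw [PsiDO.map_sub, PsiDO.map_mul h, PsiDO.map_mul h, map_specialize_formalOp hL]
    rfl
  rw [e]
  rfl

/-- The operators `B_j` are the positive parts of the powers of an `n`-th root of `L`. -/
theorem exists_root_posPart [CharZero K] (hn : 1 ≤ n) (hL : L.IsNormalForm n) :
    ∃ R : PsiDO K, R.IsMonicOfOrder 1 ∧ R ^ n = L.toPsiDO ∧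
      ∀ j, almostCommutingOp n L j = (R ^ j).posPart := by
  obtain ⟨h1, h2⟩ := nthRoot_formalOp_spec (K := K) n hn
  have h := specialize_deriv (n := n) L
  -- The witness is the coefficientwise specialization of the formal root.
  refine ⟨_, h1.map (specialize n L).toRingHom, ?_, fun j => ?_⟩
  · rw [← PsiDO.map_pow h, h2, map_specialize_formalOp hL]
  · apply Subtype.ext
    rw [← PsiDO.map_pow h]
    ext i
    change specialize n L (if 0 ≤ i then _ else 0) = if 0 ≤ i then _ else _
    split_ifs
    · rfl
    · exact map_zero _

end Specialization

/-! ### Leading terms -/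

namespace DiffOp

section Lead

variable {K : Type*} [Field K] [Differential K]

/-- The coefficient of `∂^i` as a linear map over the constants. -/
noncomputable def coeffLin (i : ℤ) : DiffOp K →ₗ[constantRing K] K where
  toFun A := A.toPsiDO.coeff i
  map_add' _ _ := rfl
  map_smul' _ _ := rfl

/-- `A` has order at most `m`, and `a` is its coefficient of `∂^m`. -/
def HasLead (A : DiffOp K) (m : ℕ) (a : K) : Prop :=
  coeffLin m A = a ∧ ∀ i : ℤ, m < i → coeffLin i A = 0

theorem eq_zero_of_coeffLin {A : DiffOp K} (h : ∀ i : ℤ, 0 ≤ i → coeffLin i A = 0) : A = 0 := by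
  apply Subtype.ext
  ext i
  rcases lt_or_ge i 0 with hi | hi
  · exact A.2 i hi
  · exact h i hi

theorem HasLead.add {A B : DiffOp K} {m : ℕ} {a b : K} (hA : A.HasLead m a) (hB : B.HasLead m b) :
    (A + B).HasLead m (a + b) :=
  ⟨by rw [map_add, hA.1, hB.1], fun i hi => by rw [map_add, hA.2 i hi, hB.2 i hi, add_zero]⟩

theorem HasLead.smul {A : DiffOp K} {m : ℕ} {a : K} (c : constantRing K) (hA : A.HasLead m a) :
    (c • A).HasLead m (c * a) :=
  ⟨by rw [map_smul, hA.1]; rfl, fun i hi => by rw [map_smul, hA.2 i hi, smul_zero]⟩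

theorem HasLead.sub {A B : DiffOp K} {m : ℕ} {a b : K} (hA : A.HasLead m a) (hB : B.HasLead m b) :
    (A - B).HasLead m (a - b) :=
  ⟨by rw [map_sub, hA.1, hB.1], fun i hi => by rw [map_sub, hA.2 i hi, hB.2 i hi, sub_zero]⟩

theorem HasLead.mul {A B : DiffOp K} {m k : ℕ} {a b : K} (hA : A.HasLead m a)
    (hB : B.HasLead k b) : (A * B).HasLead (m + k) (a * b) := by
  refine ⟨?_, fun i hi => PsiDO.mul_coeff_eq_zero hA.2 hB.2 i (by push_cast at hi; omega)⟩
  rw [← hA.1, ← hB.1]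
  push_cast
  exact PsiDO.mul_coeff_top hA.2 hB.2

theorem hasLead_one : (1 : DiffOp K).HasLead 0 1 := PsiDO.isMonicOfOrder_one

theorem HasLead.pow {A : DiffOp K} {m : ℕ} (hA : A.HasLead m 1) (k : ℕ) :
    (A ^ k).HasLead (k * m) 1 := by
  induction k with
  | zero => simpa using hasLead_one
  | succ k ih => simpa [pow_succ, Nat.succ_mul] using ih.mul hA

theorem HasLead.of_lt {A : DiffOp K} {m k : ℕ} {a : K} (hA : A.HasLead m a) (h : m < k) :
    A.HasLead k 0 := ⟨hA.2 k (by omega), fun i hi => hA.2 i (by omega)⟩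

theorem HasLead.sum {ι : Type*} (s : Finset ι) {A : ι → DiffOp K} {m : ℕ} {a : ι → K}
    (h : ∀ i ∈ s, (A i).HasLead m (a i)) : (∑ i ∈ s, A i).HasLead m (∑ i ∈ s, a i) :=
  ⟨by rw [map_sum]; exact Finset.sum_congr rfl fun i hi => (h i hi).1,
    fun j hj => by rw [map_sum]; exact Finset.sum_eq_zero fun i hi => (h i hi).2 j hj⟩

theorem HasLead.eq_of_ne_zero {A : DiffOp K} {m k : ℕ} {a b : K} (hA : A.HasLead m a)
    (hB : A.HasLead k b) (ha : a ≠ 0) (hb : b ≠ 0) : m = k := by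
  rcases lt_trichotomy m k with h | h | h
  · exact absurd (hB.1.symm.trans (hA.2 k (by omega))) hb
  · exact h
  · exact absurd (hA.1.symm.trans (hB.2 m (by omega))) ha

theorem HasLead.ne_zero {A : DiffOp K} {m : ℕ} {a : K} (hA : A.HasLead m a) (ha : a ≠ 0) :
    A ≠ 0 := by
  rintro rfl
  exact ha (hA.1.symm.trans (map_zero _))

theorem exists_hasLead {A : DiffOp K} (hA : A ≠ 0) : ∃ m a, a ≠ 0 ∧ A.HasLead m a := by
  obtain ⟨N, hN⟩ : ∃ N : ℕ, ∀ i : ℤ, (N : ℤ) ≤ i → coeffLin i A = 0 := by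
    obtain ⟨N, hN⟩ := A.1.bdd
    exact ⟨(N + 1).toNat, fun i hi => hN i (by omega)⟩
  induction N with
  | zero => exact absurd (eq_zero_of_coeffLin hN) hA
  | succ N ih =>
    by_cases h : coeffLin (N : ℤ) A = 0
    · refine ih fun i hi => ?_
      rcases eq_or_lt_of_le hi with rfl | hi'
      · exact h
      · exact hN i (by push_cast; omega)
    · exact ⟨N, _, h, rfl, fun i hi => hN i (by push_cast; omega)⟩

theorem ord_le_iff (A : DiffOp K) (m : ℤ) : A.ord ≤ m ↔ ∀ i : ℤ, m < i → coeffLin i A = 0 :=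
  PsiDO.ord_le_iff _ _

theorem HasLead.ord_eq {A : DiffOp K} {m : ℕ} {a : K} (hA : A.HasLead m a) (ha : a ≠ 0) :
    A.ord = ((m : ℤ) : WithBot ℤ) := by
  refine le_antisymm ((ord_le_iff _ _).2 hA.2) ?_
  by_contra! h
  have h' : A.ord ≤ ((m - 1 : ℤ) : WithBot ℤ) := by
    generalize A.ord = o at h ⊢
    cases o with
    | bot => exact bot_le
    | coe o => rw [WithBot.coe_lt_coe] at h; rw [WithBot.coe_le_coe]; omega
  exact ha (hA.1.symm.trans ((ord_le_iff _ _).1 h' m (by omega)))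

theorem ord_zero : (0 : DiffOp K).ord = ⊥ := if_pos rfl

theorem ord_eq_iff {A : DiffOp K} {m : ℤ} :
    A.ord = (m : WithBot ℤ) ↔ ∃ (k : ℕ) (a : K), m = k ∧ a ≠ 0 ∧ A.HasLead k a := by
  constructor
  · intro h
    have h0 : A ≠ 0 := by
      rintro rfl
      rw [ord_zero] at h
      exact WithBot.bot_ne_coe h
    obtain ⟨k, a, ha, hA⟩ := exists_hasLead h0
    rw [hA.ord_eq ha, WithBot.coe_inj] at h
    exact ⟨k, a, h.symm, ha, hA⟩
  · rintro ⟨k, a, rfl, ha, hA⟩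
    exact hA.ord_eq ha

/-- When the degrees `m i` are pairwise distinct, the term of largest degree is alone at the top, so
nothing can cancel it. The independence arguments below all rest on this. -/
theorem HasLead.exists_sum_of_injOn {ι : Type*} (s : Finset ι) {A : ι → DiffOp K} {m : ι → ℕ}
    {a : ι → K} (h : ∀ i ∈ s, (A i).HasLead (m i) (a i))
    (hm : Set.InjOn m s) (hs : s.Nonempty) :
    ∃ i ∈ s, (∑ j ∈ s, A j).HasLead (m i) (a i) := by
  classical
  obtain ⟨i, hi, hmax⟩ := s.exists_max_image m hs
  refine ⟨i, hi, ?_⟩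
  rw [← Finset.add_sum_erase s A hi]
  have h2 := HasLead.sum (s.erase i) (A := A) (m := m i) (a := fun _ => 0) fun j hj => by
    have hj' := Finset.mem_erase.1 hj
    exact (h j hj'.2).of_lt (lt_of_le_of_ne (hmax j hj'.2) fun e => hj'.1 (hm hj'.2 hi e))
  simpa using (h i hi).add h2

end Lead

end DiffOp

/-! ### Almost commuting operators and reduction modulo a subspace -/

section Centralizer

open DiffOp

variable {K : Type*} [Field K] [Differential K] {n : ℕ} {L : DiffOp K}

theorem inv_mem_constantRing (c : constantRing K) : (c : K)⁻¹ ∈ constantRing K := by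
  change ((c : K)⁻¹)′ = 0
  rw [Derivation.leibniz_inv, show (c : K)′ = 0 from c.2, smul_zero]

theorem mem_centralizer_iff {A : DiffOp K} : A ∈ centralizer L ↔ A * L = L * A := by
  unfold centralizer
  rw [Subalgebra.mem_centralizer_iff]
  simp [eq_comm]

/-- The commutator with `L`. -/
noncomputable def commutatorLin (L : DiffOp K) : DiffOp K →ₗ[constantRing K] DiffOp K :=
  LinearMap.mulRight (constantRing K) L - LinearMap.mulLeft (constantRing K) L

theorem commutatorLin_apply (A : DiffOp K) : commutatorLin L A = A * L - L * A := rfl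

theorem mem_centralizer_iff_commutatorLin {A : DiffOp K} :
    A ∈ centralizer L ↔ commutatorLin L A = 0 := by
  rw [mem_centralizer_iff, commutatorLin_apply, sub_eq_zero]

variable (n L) in
/-- The operators `A` such that `[A, L]` has order at most `n - 2`. -/
noncomputable def almostCentralizer : Submodule (constantRing K) (DiffOp K) where
  carrier := {A | ∀ i : ℤ, n - 2 < i → coeffLin i (commutatorLin L A) = 0}
  add_mem' hA hB i hi := by rw [map_add, map_add, hA i hi, hB i hi, add_zero]
  zero_mem' i _ := by rw [map_zero, map_zero]
  smul_mem' c A hA i hi := by rw [map_smul, map_smul, hA i hi, smul_zero]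

theorem mem_almostCentralizer_of_mem_centralizer {A : DiffOp K} (hA : A ∈ centralizer L) :
    A ∈ almostCentralizer n L := fun i _ => by
  rw [mem_centralizer_iff_commutatorLin.1 hA, map_zero]

theorem DiffOp.IsNormalForm.hasLead (hL : L.IsNormalForm n) : L.HasLead n 1 := hL.1

/-- The coefficient of ∂^{m+n-1} in the commutator is -n a', and it vanishes because m + n - 1 > n -
2. -/
theorem leadingCoeff_mem_constantRing [CharZero K] (hn : 1 ≤ n) (hL : L.IsNormalForm n)
    {A : DiffOp K} (hA : A ∈ almostCentralizer n L) {m : ℕ} {a : K} (h : A.HasLead m a) :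
    a ∈ constantRing K := by
  have h1 := PsiDO.commutator_coeff_top h.2 hL.1
  have h2 := hA (m + n - 1) (by omega)
  have h3 : -((n : ℤ) * (coeffLin (m : ℤ) A)′ : K) = 0 := h1.symm.trans h2
  rw [h.1] at h3
  have hn' : (n : K) ≠ 0 := by exact_mod_cast (by omega : n ≠ 0)
  change a′ = 0
  simpa [hn'] using h3

/-- The power R^j commutes with L = R^n, so B_j may be replaced in the commutator by minus the
negative part of R^j, of order at most -1; the bound is then (-1) + n - 1 = n - 2. -/
theorem almostCommutingOp_spec [CharZero K] (hn : 1 ≤ n) (hL : L.IsNormalForm n) (j : ℕ) :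
    (almostCommutingOp n L j).HasLead j 1 ∧ almostCommutingOp n L j ∈ almostCentralizer n L := by
  obtain ⟨R, hR, hRn, hB⟩ := exists_root_posPart hn hL
  have hRj := hR.pow j
  have hc (i : ℤ) : (almostCommutingOp n L j).toPsiDO.coeff i =
      if 0 ≤ i then (R ^ j).coeff i else 0 := by rw [hB]; rfl
  refine ⟨⟨(hc j).trans (by rw [if_pos (by omega), hRj.1]), fun i hi => (hc i).trans
    (by rw [hRj.2 i hi, ite_self])⟩, fun i hi => ?_⟩
  set B := (almostCommutingOp n L j).toPsiDO
  have hcomm : R ^ j * L.toPsiDO = L.toPsiDO * R ^ j := by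
    rw [← hRn, ← pow_add, ← pow_add, add_comm]
  have hneg : ∀ i : ℤ, -1 < i → (B - R ^ j).coeff i = 0 := fun i hi => by
    rw [PsiDO.sub_coeff, hc, if_pos (by omega), sub_self]
  have h := PsiDO.commutator_coeff_eq_zero hneg hL.1.2 i (by omega)
  have e : (B - R ^ j) * L.toPsiDO - L.toPsiDO * (B - R ^ j) =
      B * L.toPsiDO - L.toPsiDO * B := by
    rw [sub_mul, mul_sub, hcomm]; abel
  rw [e] at h
  exact h

theorem almostCommutingOp_zero [CharZero K] (hn : 1 ≤ n) (hL : L.IsNormalForm n) :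
    almostCommutingOp n L 0 = 1 := by
  obtain ⟨R, -, -, hB⟩ := exists_root_posPart hn hL
  rw [hB, pow_zero]
  apply Subtype.ext
  ext i
  change (if 0 ≤ i then (1 : PsiDO K).coeff i else 0) = (1 : PsiDO K).coeff i
  rw [PsiDO.one_coeff]
  split_ifs with h1 h2 <;> first | rfl | omega

/-- The combination stays in `almostCentralizer`, so the equations for k ≤ n - 2 account for every
coefficient of its commutator that could be nonzero. -/
theorem isGDSolution_iff [CharZero K] (hn : 1 ≤ n) (hL : L.IsNormalForm n) (m : ℕ) (J : Finset ℕ)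
    (c : J → constantRing K) : IsGDSolution n L m J c ↔
      almostCommutingOp n L m + ∑ j, c j • almostCommutingOp n L (j : ℕ) ∈ centralizer L := by
  have hW : almostCommutingOp n L m + ∑ j, c j • almostCommutingOp n L (j : ℕ) ∈
      almostCentralizer n L :=
    add_mem (almostCommutingOp_spec hn hL m).2
      (sum_mem fun j _ => Submodule.smul_mem _ _ (almostCommutingOp_spec hn hL j).2)
  have hc (k : ℕ) : coeffLin (k : ℤ) (commutatorLin L
      (almostCommutingOp n L m + ∑ j, c j • almostCommutingOp n L (j : ℕ))) =
      gdCoeff n L k m + ∑ j : J, (c j : K) * gdCoeff n L k j := by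
    simp only [map_add, map_sum, map_smul, gdCoeff_eq n L hL]
    rfl
  rw [mem_centralizer_iff_commutatorLin]
  constructor
  · intro h
    refine eq_zero_of_coeffLin fun i hi => ?_
    obtain ⟨k, rfl⟩ := Int.eq_ofNat_of_zero_le hi
    by_cases hk : k + 2 ≤ n
    · exact (hc k).trans (h k hk)
    · exact hW _ (by omega)
  · intro h k _
    rw [← hc, h, map_zero]

/-- Division with remainder: leading terms are removed from the top down, and only the orders
missing from `T` contribute to the remainder. Taking `V` arbitrary serves both the whole centralizer
and spans of part of a basis. -/
theorem exists_sub_sum_almostCommutingOp_mem [CharZero K] (hn : 1 ≤ n) (hL : L.IsNormalForm n)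
    {V : Submodule (constantRing K) (DiffOp K)} (hV : V ≤ almostCentralizer n L) {T : Set ℕ}
    (hT : ∀ j ∈ T, ∃ X ∈ V, X.HasLead j 1) (N : ℕ) {A : DiffOp K}
    (hA : A ∈ almostCentralizer n L) (hAN : ∀ i : ℤ, N ≤ i → coeffLin i A = 0) :
    ∃ c : ℕ → constantRing K, ∀ J : Finset ℕ, (∀ j, j ∈ J ↔ j < N ∧ j ∉ T) →
      A - ∑ j ∈ J, c j • almostCommutingOp n L j ∈ V := by
  classical
  induction N generalizing A with
  | zero =>
    refine ⟨0, fun J _ => ?_⟩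
    rw [eq_zero_of_coeffLin hAN]
    simp
  | succ N ih =>
    have hlead : A.HasLead N (coeffLin N A) := ⟨rfl, fun i hi => hAN i (by push_cast; omega)⟩
    obtain ⟨a, ha⟩ : ∃ a : constantRing K, (a : K) = coeffLin N A :=
      ⟨⟨_, leadingCoeff_mem_constantRing hn hL hA hlead⟩, rfl⟩
    have hsub {X : DiffOp K} (hX : X.HasLead N 1) :
        ∀ i : ℤ, N ≤ i → coeffLin i (A - a • X) = 0 := by
      have h := hlead.sub (hX.smul a)
      rw [ha, mul_one, sub_self] at h
      intro i hi
      rcases eq_or_lt_of_le hi with rfl | hi'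
      · exact h.1
      · exact h.2 i hi'
    -- At an order in `T` the leading term is removed by an element of `V`, which leaves no trace;
    -- otherwise it is removed by B_N, and its coefficient is recorded.
    by_cases hN : N ∈ T
    · obtain ⟨X, hXV, hX⟩ := hT N hN
      obtain ⟨c, hc⟩ := ih (sub_mem hA (Submodule.smul_mem _ a (hV hXV))) (hsub hX)
      refine ⟨c, fun J hJ => ?_⟩
      have h := add_mem (hc J fun j => ?_) (Submodule.smul_mem _ a hXV)
      · convert h using 1
        abel
      · rw [hJ]
        refine and_congr_left fun hj => ⟨fun h => ?_, fun h => by omega⟩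
        have : j ≠ N := by rintro rfl; exact hj hN
        omega
    · have hB := almostCommutingOp_spec hn hL N
      obtain ⟨c, hc⟩ := ih (sub_mem hA (Submodule.smul_mem _ a hB.2)) (hsub hB.1)
      refine ⟨Function.update c N a, fun J hJ => ?_⟩
      have hNJ : N ∈ J := (hJ N).2 ⟨by omega, hN⟩
      have h := hc (J.erase N) fun j => by
        rw [Finset.mem_erase, hJ]
        constructor
        · rintro ⟨h1, h2, h3⟩; exact ⟨by omega, h3⟩
        · rintro ⟨h1, h2⟩; exact ⟨by omega, by omega, h2⟩
      convert h using 1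
      rw [← Finset.add_sum_erase J _ hNJ, Function.update_self, sub_sub]
      congr 2
      refine Finset.sum_congr rfl fun j hj => ?_
      rw [Function.update_of_ne (Finset.ne_of_mem_erase hj)]

theorem exists_almostCommutingOp_add_sum_mem [CharZero K] (hn : 1 ≤ n) (hL : L.IsNormalForm n)
    {V : Submodule (constantRing K) (DiffOp K)} (hV : V ≤ almostCentralizer n L) {T : Set ℕ}
    (hT : ∀ j ∈ T, ∃ X ∈ V, X.HasLead j 1) {m : ℕ} {A : DiffOp K} (hA : A ∈ V)
    (hAm : A.HasLead m 1) {J : Finset ℕ} (hJ : ∀ j, j ∈ J ↔ j < m ∧ j ∉ T) :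
    ∃ c : J → constantRing K,
      almostCommutingOp n L m + ∑ j, c j • almostCommutingOp n L (j : ℕ) ∈ V := by
  have hB := almostCommutingOp_spec hn hL m
  -- Both operators are monic of order m, so their difference has order below m and the remainder
  -- involves only indices below m.
  have h := hB.1.sub hAm
  rw [sub_self] at h
  obtain ⟨c, hc⟩ := exists_sub_sum_almostCommutingOp_mem hn hL hV hT m (sub_mem hB.2 (hV hA))
    fun i hi => by
      rcases eq_or_lt_of_le hi with rfl | hi'
      · exact h.1
      · exact h.2 i hi'
  refine ⟨fun j => -c j, ?_⟩
  convert add_mem (hc J hJ) hA using 1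
  rw [← Finset.sum_coe_sort J]
  simp only [neg_smul, Finset.sum_neg_distrib]
  abel

variable (L) in
/-- The orders of the nonzero elements of the centralizer. -/
def centralizerOrders : Set ℕ := {m | ∃ A ∈ centralizer L, A.HasLead m 1}

/-- The leading coefficient is constant, so dividing by it stays in the centralizer and gives a
monic element. -/
theorem mem_centralizerOrders [CharZero K] (hn : 1 ≤ n) (hL : L.IsNormalForm n) {A : DiffOp K}
    (hA : A ∈ centralizer L) {m : ℕ} {a : K} (ha : a ≠ 0) (h : A.HasLead m a) :
    m ∈ centralizerOrders L := by
  obtain ⟨c, rfl⟩ : ∃ c : constantRing K, (c : K) = a := ⟨⟨a, leadingCoeff_mem_constantRing hn hL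
    (mem_almostCentralizer_of_mem_centralizer hA) h⟩, rfl⟩
  have h' := h.smul ⟨_, inv_mem_constantRing c⟩
  rw [inv_mul_cancel₀ ha] at h'
  exact ⟨_, Subalgebra.smul_mem _ hA _, h'⟩

/-- The largest index with a nonzero coefficient would be the order of a nonzero element of the
centralizer. -/
theorem coeff_eq_zero_of_sum_mem_centralizer [CharZero K] (hn : 1 ≤ n) (hL : L.IsNormalForm n)
    (J : Finset ℕ) (hJ : ∀ j ∈ J, j ∉ centralizerOrders L) (e : ℕ → constantRing K)
    (h : ∑ j ∈ J, e j • almostCommutingOp n L j ∈ centralizer L) : ∀ j ∈ J, e j = 0 := by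
  classical
  by_contra! hne
  obtain ⟨j, hj, hje⟩ := hne
  obtain ⟨i, hi, hlead⟩ := HasLead.exists_sum_of_injOn (J.filter fun j => e j ≠ 0)
    (A := fun j => e j • almostCommutingOp n L j) (m := id) (a := fun j => (e j : K) * 1)
    (fun j _ => (almostCommutingOp_spec hn hL j).1.smul (e j))
    Function.injective_id.injOn
    ⟨j, Finset.mem_filter.2 ⟨hj, hje⟩⟩
  rw [Finset.sum_filter_of_ne fun j _ hj => by rintro h0; simp [h0] at hj] at hlead
  have hi' := Finset.mem_filter.1 hi
  exact hJ i hi'.1 (mem_centralizerOrders hn hL h (by simpa using hi'.2) hlead)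

theorem isGDSolution_unique [CharZero K] (hn : 1 ≤ n) (hL : L.IsNormalForm n) {m : ℕ}
    {J : Finset ℕ} (hJ : ∀ j ∈ J, j ∉ centralizerOrders L) {c c' : J → constantRing K}
    (h : IsGDSolution n L m J c) (h' : IsGDSolution n L m J c') : c' = c := by
  classical
  rw [isGDSolution_iff hn hL] at h h'
  have hs := sub_mem h' h
  -- B_m cancels in the difference of the two solutions; the coefficients are extended by 0 outside
  -- `J`.
  have := coeff_eq_zero_of_sum_mem_centralizer hn hL J hJ
    (fun j => if hj : j ∈ J then c' ⟨j, hj⟩ - c ⟨j, hj⟩ else 0) (by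
      convert hs using 1
      rw [← Finset.sum_coe_sort J, add_sub_add_left_eq_sub, ← Finset.sum_sub_distrib]
      refine Finset.sum_congr rfl fun j _ => ?_
      rw [dif_pos j.2, sub_smul])
  funext j
  have hj := this j j.2
  rw [dif_pos j.2] at hj
  exact sub_eq_zero.1 hj

end Centralizer

/-! ### Least representatives modulo n -/

/-- The elements of `S` that are least in their class modulo `n`. -/
def minimalRepresentatives (n : ℕ) (S : Set ℕ) : Set ℕ :=
  {m | m ∈ S ∧ ∀ s ∈ S, (s : ZMod n) = m → m ≤ s}

theorem minimalRepresentatives_injOn (n : ℕ) (S : Set ℕ) :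
    Set.InjOn (fun m : ℕ => (m : ZMod n)) (minimalRepresentatives n S) :=
  fun _ ha _ hb h => le_antisymm (ha.2 _ hb.1 h.symm) (hb.2 _ ha.1 h)

theorem exists_minimalRepresentatives (n : ℕ) {S : Set ℕ} {s : ℕ} (hs : s ∈ S) :
    ∃ m ∈ minimalRepresentatives n S, (m : ZMod n) = s ∧ m ≤ s := by
  classical
  have h : ∃ m, m ∈ S ∧ (m : ZMod n) = s := ⟨s, hs, rfl⟩
  have h1 := Nat.find_spec h
  exact ⟨Nat.find h, ⟨h1.1, fun t ht hts => Nat.find_min' h ⟨ht, hts.trans h1.2⟩⟩, h1.2,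
    Nat.find_min' h ⟨hs, rfl⟩⟩

theorem image_minimalRepresentatives (n : ℕ) (S : Set ℕ) :
    (fun m : ℕ => (m : ZMod n)) '' minimalRepresentatives n S =
      (fun m : ℕ => (m : ZMod n)) '' S := by
  ext x
  constructor
  · rintro ⟨m, hm, rfl⟩
    exact ⟨m, hm.1, rfl⟩
  · rintro ⟨s, hs, rfl⟩
    obtain ⟨m, hm, h, -⟩ := exists_minimalRepresentatives n hs
    exact ⟨m, hm, h⟩

theorem finite_minimalRepresentatives {n : ℕ} (hn : 1 ≤ n) (S : Set ℕ) :
    (minimalRepresentatives n S).Finite := by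
  have : NeZero n := ⟨by omega⟩
  exact Set.Finite.of_finite_image (Set.toFinite _) (minimalRepresentatives_injOn n S)

theorem exists_eq_mul_add_of_natCast_eq {n a b : ℕ} (h : (a : ZMod n) = b) (hab : a ≤ b) :
    ∃ k, b = a + k * n := by
  obtain ⟨k, hk⟩ := (Nat.modEq_iff_dvd' hab).1 ((ZMod.natCast_eq_natCast_iff _ _ _).1 h)
  exact ⟨k, by rw [mul_comm]; omega⟩

/-! ### The centralizer as a module over C[L] -/

section Centralizer

open DiffOp

variable {K : Type*} [Field K] [Differential K] {n : ℕ} {L : DiffOp K}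

theorem mem_centralizer_self : L ∈ centralizer L := mem_centralizer_iff.2 rfl

theorem orderClasses_eq [CharZero K] (hn : 1 ≤ n) (hL : L.IsNormalForm n) :
    orderClasses n L = (fun m : ℕ => (m : ZMod n)) '' centralizerOrders L := by
  ext x
  constructor
  · rintro ⟨Q, hQ, m, hm, rfl⟩
    obtain ⟨k, a, rfl, ha, h⟩ := ord_eq_iff.1 hm
    exact ⟨k, mem_centralizerOrders hn hL hQ ha h, by simp⟩
  · rintro ⟨k, ⟨A, hA, h⟩, rfl⟩
    exact ⟨A, hA, k, h.ord_eq one_ne_zero, by simp⟩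

theorem ncard_orderClasses [CharZero K] (hn : 1 ≤ n) (hL : L.IsNormalForm n) :
    (orderClasses n L).ncard = (minimalRepresentatives n (centralizerOrders L)).ncard := by
  rw [orderClasses_eq hn hL, ← image_minimalRepresentatives,
    Set.InjOn.ncard_image (minimalRepresentatives_injOn n _)]

/-- A finite set of d integers has only one increasing enumeration by `Fin d`; the last clause later
identifies the orders of two bases. -/
theorem exists_strictMono_minimalRepresentatives [CharZero K] (hn : 1 ≤ n)
    (hL : L.IsNormalForm n) : ∃ M : Fin (orderClasses n L).ncard → ℕ, StrictMono M ∧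
      Set.range M = minimalRepresentatives n (centralizerOrders L) ∧
      ∀ M' : Fin (orderClasses n L).ncard → ℕ, StrictMono M' →
        (∀ i, M' i ∈ minimalRepresentatives n (centralizerOrders L)) → M' = M := by
  have hfin := finite_minimalRepresentatives hn (centralizerOrders L)
  have hcard : hfin.toFinset.card = (orderClasses n L).ncard := by
    rw [ncard_orderClasses hn hL, Set.ncard_eq_toFinset_card _ hfin]
  refine ⟨hfin.toFinset.orderEmbOfFin hcard, OrderEmbedding.strictMono _, by simp, ?_⟩
  intro M' hM' h
  exact Finset.orderEmbOfFin_unique hcard (fun i => by simpa using h i) hM'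

theorem exists_hasLead_of_mem_polyRing (hn : 1 ≤ n) (hL : L.IsNormalForm n) {p : DiffOp K}
    (hp : p ∈ polyRing L) (h0 : p ≠ 0) : ∃ (h : ℕ) (a : K), a ≠ 0 ∧ p.HasLead (h * n) a := by
  classical
  unfold polyRing at hp
  rw [Algebra.adjoin_singleton_eq_range_aeval] at hp
  obtain ⟨q, rfl⟩ := hp
  change Polynomial.aeval L q ≠ 0 at h0
  change ∃ (h : ℕ) (a : K), a ≠ 0 ∧ (Polynomial.aeval L q).HasLead (h * n) a
  have hq : q.support.Nonempty := by
    rw [Polynomial.support_nonempty]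
    rintro rfl
    exact h0 (map_zero _)
  rw [Polynomial.aeval_def, Polynomial.eval₂_eq_sum, Polynomial.sum_def]
  simp only [← Algebra.smul_def]
  obtain ⟨i, hi, h⟩ := HasLead.exists_sum_of_injOn q.support
    (A := fun i => q.coeff i • L ^ i) (m := fun i => i * n) (a := fun i => (q.coeff i : K) * 1)
    (fun i _ => (hL.hasLead.pow i).smul _)
    (fun i _ j _ h => Nat.eq_of_mul_eq_mul_right (by omega) h) hq
  exact ⟨i, _, by simpa using hi, h⟩

/-- Nonzero elements of C[L] have order divisible by n, so the order of p_i G_i is congruent to M_i.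
The classes being distinct, no two nonzero summands have the same order. -/
theorem exists_hasLead_sum_mul (hn : 1 ≤ n) (hL : L.IsNormalForm n) {ι : Type*} [Fintype ι]
    {G : ι → DiffOp K} {M : ι → ℕ} (hG : ∀ i, (G i).HasLead (M i) 1)
    (hM : Function.Injective fun i => (M i : ZMod n)) (p : ι → polyRing L) (hp : ∃ i, p i ≠ 0) :
    ∃ (k : ι) (h : ℕ) (a : K), a ≠ 0 ∧ (∑ i, (p i : DiffOp K) * G i).HasLead (h * n + M k) a := by
  classical
  -- The guard makes `h` and `a` total functions, with junk value 0 where p_i = 0.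
  have key (i : ι) : ∃ (h : ℕ) (a : K), p i ≠ 0 →
      a ≠ 0 ∧ ((p i : DiffOp K) * G i).HasLead (h * n + M i) a := by
    by_cases hi : p i = 0
    · exact ⟨0, 0, fun h => absurd hi h⟩
    · obtain ⟨h, a, ha, hl⟩ := exists_hasLead_of_mem_polyRing hn hL (p i).2
        (fun h => hi (Subtype.ext h))
      exact ⟨h, a, fun _ => ⟨ha, by simpa using hl.mul (hG i)⟩⟩
  choose h a ha using key
  obtain ⟨i, hi, hl⟩ := HasLead.exists_sum_of_injOn (Finset.univ.filter fun i => p i ≠ 0)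
    (A := fun i => (p i : DiffOp K) * G i) (m := fun i => h i * n + M i) (a := a)
    (fun i hi => (ha i (Finset.mem_filter.1 hi).2).2)
    (fun i _ j _ hij => hM (by
      have := congrArg (Nat.cast : ℕ → ZMod n) hij
      simpa using this))
    (hp.imp fun i hi => Finset.mem_filter.2 ⟨Finset.mem_univ _, hi⟩)
  rw [Finset.sum_filter_of_ne fun j _ hj => by rintro h0; simp [h0] at hj] at hl
  exact ⟨i, h i, a i, (ha i (Finset.mem_filter.1 hi).2).1, hl⟩

variable (L) in
/-- The `C[L]`-span of a set of operators as a space over the constants. -/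
noncomputable def polySpan (s : Set (DiffOp K)) : Submodule (constantRing K) (DiffOp K) where
  carrier := Submodule.span (polyRing L) s
  add_mem' := add_mem
  zero_mem' := zero_mem _
  smul_mem' c A hA := by
    rw [Algebra.smul_def]
    exact Submodule.smul_mem _ (⟨_, Subalgebra.algebraMap_mem _ c⟩ : polyRing L) hA

theorem polySpan_le_centralizer {s : Set (DiffOp K)} (hs : ∀ A ∈ s, A ∈ centralizer L) :
    polySpan L s ≤ (centralizer L).toSubmodule := by
  have h : Submodule.span (polyRing L) s ≤ centralizerModule L := Submodule.span_le.2 hs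
  exact fun A hA => h hA

theorem centralizer_le_almostCentralizer :
    (centralizer L).toSubmodule ≤ almostCentralizer n L :=
  fun _ hA => mem_almostCentralizer_of_mem_centralizer hA

theorem pow_mul_mem_polySpan {s : Set (DiffOp K)} {A : DiffOp K} (hA : A ∈ s) (h : ℕ) :
    L ^ h * A ∈ polySpan L s := by
  have hL : L ^ h ∈ polyRing L :=
    pow_mem (Algebra.subset_adjoin (Set.mem_singleton L)) h
  exact Submodule.smul_mem (Submodule.span (polyRing L) s) (⟨L ^ h, hL⟩ : polyRing L)
    (Submodule.subset_span hA)

theorem add_mul_mem_centralizerOrders (hL : L.IsNormalForm n) {m : ℕ}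
    (hm : m ∈ centralizerOrders L) (h : ℕ) : m + h * n ∈ centralizerOrders L := by
  obtain ⟨A, hA, hl⟩ := hm
  refine ⟨L ^ h * A, mul_mem (pow_mem mem_centralizer_self h) hA, ?_⟩
  have := (hL.hasLead.pow h).mul hl
  rwa [one_mul, add_comm] at this

/-- Divide A by the L^h G_i, whose orders exhaust `centralizerOrders L`. The remainder lies in the
centralizer and involves only B_j with j a gap, so it is zero. -/
theorem mem_span_of_forall_centralizerOrders [CharZero K] (hn : 1 ≤ n) (hL : L.IsNormalForm n)
    {ι : Type*} {G : ι → DiffOp K} {M : ι → ℕ} (hGZ : ∀ i, G i ∈ centralizer L)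
    (hG : ∀ i, (G i).HasLead (M i) 1)
    (hM : ∀ s ∈ centralizerOrders L, ∃ i h, s = M i + h * n) {A : DiffOp K}
    (hA : A ∈ centralizer L) : A ∈ Submodule.span (polyRing L) (Set.range G) := by
  classical
  have hV := polySpan_le_centralizer (L := L) (s := Set.range G)
    (by rintro _ ⟨i, rfl⟩; exact hGZ i)
  obtain ⟨N, hN⟩ : ∃ N : ℕ, ∀ i : ℤ, (N : ℤ) ≤ i → coeffLin i A = 0 := by
    obtain ⟨N, hN⟩ := A.1.bdd
    exact ⟨(N + 1).toNat, fun i hi => hN i (by omega)⟩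
  obtain ⟨c, hc⟩ := exists_sub_sum_almostCommutingOp_mem hn hL
    (hV.trans centralizer_le_almostCentralizer) (T := centralizerOrders L) (fun s hs => by
      obtain ⟨i, h, rfl⟩ := hM s hs
      refine ⟨L ^ h * G i, pow_mul_mem_polySpan (Set.mem_range_self i) h, ?_⟩
      have := (hL.hasLead.pow h).mul (hG i)
      rwa [one_mul, add_comm] at this) N (mem_almostCentralizer_of_mem_centralizer hA) hN
  have h := hc ((Finset.range N).filter (· ∉ centralizerOrders L)) (by simp)
  have h0 := coeff_eq_zero_of_sum_mem_centralizer hn hL _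
    (fun j hj => (Finset.mem_filter.1 hj).2) c (by
      have := sub_mem hA (hV h)
      rwa [sub_sub_cancel] at this)
  rw [Finset.sum_eq_zero fun j hj => by rw [h0 j hj, zero_smul], sub_zero] at h
  exact h

theorem hasLead_almostCommutingOp_add_sum [CharZero K] (hn : 1 ≤ n) (hL : L.IsNormalForm n)
    {m : ℕ} {J : Finset ℕ} (hJ : ∀ j ∈ J, j < m) (c : J → constantRing K) :
    (almostCommutingOp n L m + ∑ j, c j • almostCommutingOp n L (j : ℕ)).HasLead m 1 := by
  have h := HasLead.sum Finset.univ (A := fun j : J => c j • almostCommutingOp n L (j : ℕ))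
    (m := m) (a := fun _ => 0) fun j _ =>
      ((almostCommutingOp_spec hn hL j).1.smul (c j)).of_lt (hJ j j.2)
  simpa using (almostCommutingOp_spec hn hL m).1.add h

theorem mem_optimizedIndices {d : ℕ} {M : Fin d → ℕ} {m j : ℕ} :
    j ∈ optimizedIndices n M m ↔
      j < m ∧ j ∉ {j | ∃ k, M k < m ∧ ∃ h : ℕ, j = M k + h * n} := by
  unfold optimizedIndices
  simp

/-- A monic element of the centralizer spans the corresponding graded piece. -/
theorem exists_linearEquiv_span_quotient [CharZero K] (hn : 1 ≤ n) (hL : L.IsNormalForm n)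
    {G : DiffOp K} (hGZ : G ∈ centralizer L) {m : ℕ} (hG : G.HasLead m 1) :
    ∃ e : Submodule.span (constantRing K) {G} ≃ₗ[constantRing K]
        (filteredCentralizer L m ⧸
          (filteredCentralizer L ((m : ℤ) - 1)).submoduleOf (filteredCentralizer L m)),
      ∀ (x : Submodule.span (constantRing K) {G}) (hx : (x : DiffOp K) ∈ filteredCentralizer L m),
        e x = Submodule.Quotient.mk ⟨x, hx⟩ := by
  have hGm : G ∈ filteredCentralizer L m := ⟨hGZ, (DiffOp.ord_le_iff _ _).2 hG.2⟩
  have hle : Submodule.span (constantRing K) {G} ≤ filteredCentralizer L m := by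
    rw [Submodule.span_singleton_le_iff_mem]; exact hGm
  let f := (Submodule.mkQ ((filteredCentralizer L ((m : ℤ) - 1)).submoduleOf
    (filteredCentralizer L m))).comp (Submodule.inclusion hle)
  refine ⟨LinearEquiv.ofBijective f ⟨?_, ?_⟩, fun x hx => rfl⟩
  · rw [injective_iff_map_eq_zero]
    rintro ⟨x, hx⟩ h
    obtain ⟨c, rfl⟩ := Submodule.mem_span_singleton.1 hx
    have h1 : c • G ∈ filteredCentralizer L ((m : ℤ) - 1) :=
      (Submodule.Quotient.mk_eq_zero _ (x := (⟨c • G, hle hx⟩ : filteredCentralizer L m))).1 h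
    have h2 := (hG.smul c).1.symm.trans ((DiffOp.ord_le_iff _ _).1 h1.2 m (by omega))
    have h3 : c = 0 := Subtype.ext (by simpa using h2)
    apply Subtype.ext
    simp [h3]
  · intro y
    obtain ⟨⟨A, hAZ, hA⟩, rfl⟩ := Submodule.Quotient.mk_surjective _ y
    have hlead : A.HasLead m (coeffLin m A) := ⟨rfl, (DiffOp.ord_le_iff _ _).1 hA⟩
    -- Surjectivity: the leading coefficient of A is constant, so A and a • G differ by an element
    -- of smaller order.
    let a : constantRing K := ⟨_, leadingCoeff_mem_constantRing hn hL
      (mem_almostCentralizer_of_mem_centralizer hAZ) hlead⟩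
    refine ⟨⟨a • G, Submodule.smul_mem _ _ (Submodule.mem_span_singleton_self G)⟩, ?_⟩
    refine (Submodule.Quotient.eq _).2 ?_
    change a • G - A ∈ filteredCentralizer L ((m : ℤ) - 1)
    refine ⟨sub_mem (Subalgebra.smul_mem _ hGZ _) hAZ, (DiffOp.ord_le_iff _ _).2 fun i hi => ?_⟩
    have h := (hG.smul a).sub hlead
    rcases eq_or_lt_of_le (show (m : ℤ) ≤ i by omega) with rfl | hi'
    · rw [h.1]; simp [a]
    · exact h.2 i hi'

theorem exists_basis_centralizerModule [CharZero K] (hn : 1 ≤ n) (hL : L.IsNormalForm n)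
    {d : ℕ} {G : Fin d → DiffOp K} {M : Fin d → ℕ} (hGZ : ∀ i, G i ∈ centralizer L)
    (hG : ∀ i, (G i).HasLead (M i) 1) (hinj : Function.Injective fun i => (M i : ZMod n))
    (hM : ∀ s ∈ centralizerOrders L, ∃ i h, s = M i + h * n) :
    ∃ b : Module.Basis (Fin d) (polyRing L) (centralizerModule L),
      ∀ i, (b i : DiffOp K) = G i := by
  let v : Fin d → centralizerModule L := fun i => ⟨G i, hGZ i⟩
  have hli : LinearIndependent (polyRing L) v := by
    rw [Fintype.linearIndependent_iffₛ]
    intro p q hpq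
    by_contra! hne
    obtain ⟨k, h, a, ha, hl⟩ := exists_hasLead_sum_mul hn hL hG hinj (fun i => p i - q i)
      (hne.imp fun i hi => sub_ne_zero.2 hi)
    apply hl.ne_zero ha
    have h := congrArg (Submodule.subtype _) hpq
    rw [map_sum, map_sum] at h
    replace h : ∑ i, (p i : DiffOp K) * G i = ∑ i, (q i : DiffOp K) * G i := h
    rw [← sub_eq_zero, ← Finset.sum_sub_distrib] at h
    rw [← h]
    exact Finset.sum_congr rfl fun i _ => sub_mul _ _ _
  have hsp : ⊤ ≤ Submodule.span (polyRing L) (Set.range v) := by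
    rintro ⟨A, hA⟩ -
    have h := mem_span_of_forall_centralizerOrders hn hL hGZ hG hM hA
    rw [show Set.range G = (Submodule.subtype (centralizerModule L)) '' Set.range v by
      rw [← Set.range_comp]; rfl, Submodule.span_image] at h
    obtain ⟨B, hB, hBA⟩ := h
    rwa [show (⟨A, hA⟩ : centralizerModule L) = B from Subtype.ext hBA.symm]
  exact ⟨Module.Basis.mk hli hsp, fun i => by rw [Module.Basis.mk_apply]⟩

theorem nontrivial_polyRing : Nontrivial (polyRing L) :=
  ⟨⟨1, 0, fun h => (hasLead_one (K := K)).ne_zero one_ne_zero (congrArg Subtype.val h)⟩⟩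

theorem notMem_polySpan_image {ι : Type*}
    (b : Module.Basis ι (polyRing L) (centralizerModule L)) {s : Set ι} {i : ι} (hi : i ∉ s) :
    (b i : DiffOp K) ∉ polySpan L ((fun i => (b i : DiffOp K)) '' s) := by
  intro h
  replace h : (b i : DiffOp K) ∈ Submodule.span (polyRing L) ((fun i => (b i : DiffOp K)) '' s) := h
  rw [show (fun i => (b i : DiffOp K)) '' s = (centralizerModule L).subtype '' (b '' s) by
    rw [Set.image_image]; rfl, Submodule.span_image] at h
  obtain ⟨B, hB, hBb⟩ := h
  obtain rfl : B = b i := Subtype.ext hBb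
  have := nontrivial_polyRing (L := L)
  rw [SetLike.mem_coe, b.mem_span_image, b.repr_self, Finsupp.support_single _ one_ne_zero] at hB
  exact hi (hB (by simp))

/-- Uniqueness of the solutions of the optimized systems forces the orders of the basis elements
to be distinct modulo `n`. -/
theorem injective_order_classes [CharZero K] (hn : 1 ≤ n) (hL : L.IsNormalForm n) {d : ℕ}
    (b : Module.Basis (Fin d) (polyRing L) (centralizerModule L)) {M : Fin d → ℕ}
    (hb : ∀ i, (b i : DiffOp K).HasLead (M i) 1) (hM : StrictMono M)
    (hc : ∀ i : Fin d, 0 < (i : ℕ) → ∃ c : optimizedIndices n M (M i) → constantRing K,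
      (∀ c', IsGDSolution n L (M i) (optimizedIndices n M (M i)) c' → c' = c) ∧
        (b i : DiffOp K) = almostCommutingOp n L (M i) +
          ∑ j, c j • almostCommutingOp n L (j : ℕ)) :
    Function.Injective fun i => (M i : ZMod n) := by
  have key (k i : Fin d) (hki : k < i) : (M k : ZMod n) ≠ M i := by
    intro heq
    obtain ⟨h, hh⟩ := exists_eq_mul_add_of_natCast_eq heq (hM hki).le
    obtain ⟨c, hcu, hbi⟩ := hc i (by have := Fin.lt_def.1 hki; omega)
    let v : Fin d → DiffOp K := fun i => b i
    have hV := polySpan_le_centralizer (L := L) (s := v '' {k | k < i})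
      (by rintro _ ⟨k, -, rfl⟩; exact (b k).2)
    have hlead (k : Fin d) (h : ℕ) : (L ^ h * v k).HasLead (M k + h * n) 1 := by
      have := (hL.hasLead.pow h).mul (hb k)
      rwa [one_mul, add_comm] at this
    -- Reduce B_{M_i} modulo the span of the earlier basis elements. The orders `T` excluded from
    -- the optimized system are those of the L^h b_k with k < i, and L^h b_k for the offending k is
    -- monic of order M_i.
    obtain ⟨c₁, hc₁⟩ := exists_almostCommutingOp_add_sum_mem hn hL
      (hV.trans centralizer_le_almostCentralizer)
      (T := {j | ∃ k, M k < M i ∧ ∃ h : ℕ, j = M k + h * n}) (by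
        rintro j ⟨k, hk, h, rfl⟩
        exact ⟨_, pow_mul_mem_polySpan (Set.mem_image_of_mem v (hM.lt_iff_lt.1 hk)) h, hlead k h⟩)
      (pow_mul_mem_polySpan (Set.mem_image_of_mem v hki) h) (hh ▸ hlead k h)
      fun j => mem_optimizedIndices
    -- By uniqueness this solution is the one defining b_i, so b_i lies in the span of its
    -- predecessors.
    obtain rfl := hcu c₁ ((isGDSolution_iff hn hL _ _ _).2 (hV hc₁))
    rw [← hbi] at hc₁
    exact notMem_polySpan_image b (s := {k | k < i}) (lt_irrefl i) hc₁
  intro k i hki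
  rcases lt_trichotomy k i with h | h | h
  · exact absurd hki (key k i h)
  · exact h
  · exact absurd hki.symm (key i k h)

/-- Expanded in the basis, an element of the centralizer has order M_k + h n for some k; its class
modulo n forces k = i, so its order is at least M_i. -/
theorem order_mem_minimalRepresentatives [CharZero K] (hn : 1 ≤ n) (hL : L.IsNormalForm n) {d : ℕ}
    (b : Module.Basis (Fin d) (polyRing L) (centralizerModule L)) {M : Fin d → ℕ}
    (hb : ∀ i, (b i : DiffOp K).HasLead (M i) 1)
    (hinj : Function.Injective fun i => (M i : ZMod n)) (i : Fin d) :
    M i ∈ minimalRepresentatives n (centralizerOrders L) := by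
  refine ⟨⟨_, (b i).2, hb i⟩, ?_⟩
  rintro s ⟨A, hA, hl⟩ hs
  have hsum := congrArg (Submodule.subtype _) (b.sum_repr ⟨A, hA⟩)
  rw [map_sum] at hsum
  replace hsum : ∑ i, (b.repr ⟨A, hA⟩ i : DiffOp K) * b i = A := hsum
  obtain ⟨k, h, a, ha, hl'⟩ := exists_hasLead_sum_mul hn hL hb hinj (b.repr ⟨A, hA⟩) (by
    by_contra! h0
    refine hl.ne_zero one_ne_zero ?_
    rw [← hsum]
    exact Finset.sum_eq_zero fun i _ => by rw [h0 i]; exact zero_mul _)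
  rw [hsum] at hl'
  have hsk := hl.eq_of_ne_zero hl' one_ne_zero ha
  have : k = i := hinj (by
    change (M k : ZMod n) = M i
    rw [← hs, hsk]
    simp)
  rw [hsk, this]
  omega

end Centralizer

/-! ### Existence and uniqueness of the basis -/

theorem mainTheorem2 {K : Type*} [Field K] [CharZero K] [Differential K] (n : ℕ) (hn : 1 ≤ n)
    (L : DiffOp K) (hL : L.IsNormalForm n) :
    ∃! b : Module.Basis (Fin (orderClasses n L).ncard) (polyRing L) (centralizerModule L),
      ∃ M : Fin (orderClasses n L).ncard → ℕ,
        (∀ i : Fin (orderClasses n L).ncard, (b i : DiffOp K).ord = ((M i : ℤ) : WithBot ℤ)) ∧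
        (∀ i : Fin (orderClasses n L).ncard, (i : ℕ) = 0 → (b i : DiffOp K) = 1) ∧
        StrictMono M ∧
        ∀ i : Fin (orderClasses n L).ncard, 0 < (i : ℕ) →
          (∃ e : Submodule.span (constantRing K) {(b i : DiffOp K)} ≃ₗ[constantRing K]
              (filteredCentralizer L (M i) ⧸
                (filteredCentralizer L ((M i : ℤ) - 1)).submoduleOf (filteredCentralizer L (M i))),
            ∀ (x : Submodule.span (constantRing K) {(b i : DiffOp K)})
              (hx : (x : DiffOp K) ∈ filteredCentralizer L (M i)),
              e x = Submodule.Quotient.mk ⟨x, hx⟩) ∧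
          ∃ c : optimizedIndices n M (M i) → constantRing K,
            IsGDSolution n L (M i) (optimizedIndices n M (M i)) c ∧
            (∀ c', IsGDSolution n L (M i) (optimizedIndices n M (M i)) c' → c' = c) ∧
            (b i : DiffOp K) = almostCommutingOp n L (M i) +
              ∑ j, c j • almostCommutingOp n L (j : ℕ) := by
  obtain ⟨M, hmono, hrange, huniq⟩ := exists_strictMono_minimalRepresentatives hn hL
  have hmin (i) : M i ∈ minimalRepresentatives n (centralizerOrders L) := hrange ▸ ⟨i, rfl⟩
  have hcover : ∀ s ∈ centralizerOrders L, ∃ i h, s = M i + h * n := fun s hs => by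
    obtain ⟨m, hm, hms, hle⟩ := exists_minimalRepresentatives n hs
    rw [← hrange] at hm
    obtain ⟨i, rfl⟩ := hm
    exact ⟨i, exists_eq_mul_add_of_natCast_eq hms hle⟩
  have hzero (i : Fin (orderClasses n L).ncard) (hi : (i : ℕ) = 0) : M i = 0 := by
    obtain ⟨k, h, hk⟩ := hcover 0 ⟨1, one_mem _, DiffOp.hasLead_one⟩
    have : M i ≤ M k := hmono.monotone (Fin.le_def.2 (by omega))
    omega
  -- For the minimal orders the optimized indices are exactly the gaps below M_i: the restriction
  -- M_k < M_i holds automatically when j = M_k + h n < M_i.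
  have hJ (i j) : j ∈ optimizedIndices n M (M i) ↔ j < M i ∧ j ∉ centralizerOrders L := by
    rw [mem_optimizedIndices]
    refine and_congr_right fun hj => not_congr ⟨?_, fun hjS => ?_⟩
    · rintro ⟨k, -, h, rfl⟩
      exact add_mul_mem_centralizerOrders hL (hmin k).1 h
    · obtain ⟨k, h, rfl⟩ := hcover j hjS
      exact ⟨k, by omega, h, rfl⟩
  have hex (i) : ∃ c : optimizedIndices n M (M i) → constantRing K,
      almostCommutingOp n L (M i) + ∑ j, c j • almostCommutingOp n L (j : ℕ) ∈ centralizer L := by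
    obtain ⟨A, hA, hl⟩ := (hmin i).1
    exact exists_almostCommutingOp_add_sum_mem hn hL (centralizer_le_almostCentralizer (L := L))
      (T := centralizerOrders L) (fun _ h => h) hA hl (hJ i)
  choose c hc using hex
  have hlead (i) := hasLead_almostCommutingOp_add_sum hn hL (fun j hj => ((hJ i j).1 hj).1) (c i)
  obtain ⟨b, hb⟩ := exists_basis_centralizerModule hn hL hc hlead
    (fun i j h => hmono.injective (minimalRepresentatives_injOn n _ (hmin i) (hmin j) h)) hcover
  have hcu (i) (c' : optimizedIndices n M (M i) → constantRing K)
      (h' : IsGDSolution n L (M i) (optimizedIndices n M (M i)) c') : c' = c i :=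
    isGDSolution_unique hn hL (fun j hj => ((hJ i j).1 hj).2)
      ((isGDSolution_iff hn hL _ _ _).2 (hc i)) h'
  have hb_one (i : Fin (orderClasses n L).ncard) (hi : (i : ℕ) = 0) : (b i : DiffOp K) = 1 := by
    have hempty : optimizedIndices n M (M i) = ∅ := Finset.eq_empty_of_forall_notMem fun j hj => by
      have := ((hJ i j).1 hj).1
      rw [hzero i hi] at this
      omega
    have := Finset.isEmpty_coe_sort.2 hempty
    rw [hb, Finset.univ_eq_empty, Finset.sum_empty, add_zero, hzero i hi,
      almostCommutingOp_zero hn hL]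
  refine ⟨b, ⟨M, fun i => ?_, hb_one, hmono, fun i _ => ⟨?_, c i,
    (isGDSolution_iff hn hL _ _ _).2 (hc i), hcu i, hb i⟩⟩, ?_⟩
  · rw [hb]
    exact (hlead i).ord_eq one_ne_zero
  · exact exists_linearEquiv_span_quotient hn hL (b i).2 (hb i ▸ hlead i)
  · rintro b' ⟨M', hord, hone, hmono', hsol⟩
    -- Monicity comes from the prescribed expression B_{M'_i} + ⋯ for i > 0 and from the element 1
    -- for i = 0.
    have hlead' (i) : (b' i : DiffOp K).HasLead (M' i) 1 := by
      rcases Nat.eq_zero_or_pos (i : ℕ) with hi | hi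
      · have h := hord i
        rw [hone i hi] at h ⊢
        rw [DiffOp.hasLead_one.ord_eq one_ne_zero, WithBot.coe_inj] at h
        rw [← Nat.cast_injective h]
        exact DiffOp.hasLead_one
      · obtain ⟨-, c', -, -, h⟩ := hsol i hi
        rw [h]
        exact hasLead_almostCommutingOp_add_sum hn hL
          (fun j hj => (mem_optimizedIndices.1 hj).1) c'
    have hinj := injective_order_classes hn hL b' hlead' hmono' fun i hi => by
      obtain ⟨-, c', -, h⟩ := hsol i hi
      exact ⟨c', h⟩
    -- Both bases now have the same orders, hence the same systems, and `hcu` identifies their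
    -- solutions.
    obtain rfl := huniq M' hmono' (order_mem_minimalRepresentatives hn hL b' hlead' hinj)
    refine Module.Basis.eq_of_apply_eq fun i => Subtype.ext ?_
    rcases Nat.eq_zero_or_pos (i : ℕ) with hi | hi
    · rw [hone i hi, hb_one i hi]
    · obtain ⟨-, c', hc', -, h⟩ := hsol i hi
      rw [h, hb, hcu i c' hc']
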